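/- Let $\mu\in(0,1)$ and $a,b>0$. For $z=(z_1,z_2)\in\mathbb{R}^2$ let $|z|$ be its Euclidean norm. Let $F:\mathbb{R}^2\to\mathbb{R}$ satisfy the following conditions. - $(F_1)$ $F$ is of class $C^1$, and there is $\kappa>2-\mu$ such that $\lim_{|z|\to0}|F_{z_j}(z)|/|z|^{\kappa}=0$ for $j=1,2$. - $(F_2)$ For $j=1,2$: $\lim_{|z|\to\infty}|F_{z_j}(z)|e^{-\alpha|z|^2}=0$ for every $\alpha>\pi$, and $|F_{z_j}(z)|e^{-\alpha|z|^2}\to+\infty$ as $|z_1|,|z_2|\to\infty$ for every $0<\alpha<\pi$. - $(F_3)$ There is $\theta>3-\mu$ such that $0<\theta F(z)\le z\cdot\nabla F(z)$ for all $z\ne(0,0)$. - $(F_7)$ There is $\beta_0>0$ such that $\liminf_{|z_1|,|z_2|\to\infty}F(z)\,[z\cdot\nabla F(z)]\,e^{-2\pi|z|^2}\ge\beta_0$. Let $H^{1/2}(\mathbb{R})$ be the space of all real $u\in L^2(\mathbb{R})$ with $\iint\frac{|u(x)-u(y)|^2}{|x-y|^2}\,dx\,dy<\infty$, put $\|(-\Delta)^{1/4}u\|_2^2=\frac1{2\pi}\iint\frac{|u(x)-u(y)|^2}{|x-y|^2}\,dx\,dy$,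 $I_\mu(x)=|x|^{-\mu}$ and $\widetilde F(z)=z\cdot\nabla F(z)-(2-\mu)F(z)$. For $u,v\in H^{1/2}(\mathbb{R})$ let $$\mathcal J(u,v)=\tfrac12\|(-\Delta)^{1/4}u\|_2^2+\tfrac12\|(-\Delta)^{1/4}v\|_2^2-\tfrac12\int_{\mathbb{R}}(I_\mu*F(u,v))F(u,v)\,dx,$$ $$P(u,v)=\|(-\Delta)^{1/4}u\|_2^2+\|(-\Delta)^{1/4}v\|_2^2-\int_{\mathbb{R}}(I_\mu*F(u,v))\widetilde F(u,v)\,dx,$$ and let $$\mathcal P(a,b)=\{(u,v)\in H^{1/2}(\mathbb{R})^2:\ \|u\|_2=a,\ \|v\|_2=b,\ P(u,v)=0\},\qquad m(a,b)=\inf_{(u,v)\in\mathcal P(a,b)}\mathcal J(u,v).$$ For $n\ge2$ let $$\varpi_n(x)=\frac1{\sqrt\pi}\begin{cases}\sqrt{\log n},&|x|<\frac1n,\\ \log\frac1{|x|}\big/\sqrt{\log n},&\frac1n\le|x|\le1,\\ 0,&|x|>1,\end{cases}\qquad \omega_n^c=\frac{c\,\varpi_n}{\|\varpi_n\|_2}\quad(c>0),$$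 and for $t\ge0$ let $\Phi_n(t)=\mathcal J\big(t\,\omega_n^a(t^2\,\cdot),\,t\,\omega_n^b(t^2\,\cdot)\big)$. Then for all sufficiently large $n$ the maximum of $\Phi_n$ over $[0,\infty)$ is attained at some $t_n>0$ and $$\max_{t\ge0}\Phi_n(t)<\frac{2-\mu}{4}.$$ Moreover $\mathcal P(a,b)$ is non-empty, $\mathcal J$ is bounded below on it, and the ground state level satisfies $m(a,b)<\frac{2-\mu}{4}$. -/

import Mathlib

noncomputable section

namespace Choquard

/-! ### The nonlinearity -/

/-- The squared Euclidean length of `z = (z₁, z₂)`. -/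
def lenSq (z : ℝ × ℝ) : ℝ := z.1 ^ 2 + z.2 ^ 2

/-- The Euclidean length of `z` (the norm of Mathlib on `ℝ × ℝ` is the sup norm). -/
def len (z : ℝ × ℝ) : ℝ := Real.sqrt (lenSq z)

/-- The partial derivative of `F` in the first variable (`F` will be of class `C¹`). -/
def partial₁ (F : ℝ × ℝ → ℝ) (z : ℝ × ℝ) : ℝ := fderiv ℝ F z (1, 0)

/-- The partial derivative of `F` in the second variable. -/
def partial₂ (F : ℝ × ℝ → ℝ) (z : ℝ × ℝ) : ℝ := fderiv ℝ F z (0, 1)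

/-- `z · ∇F(z)`. -/
def radial (F : ℝ × ℝ → ℝ) (z : ℝ × ℝ) : ℝ := z.1 * partial₁ F z + z.2 * partial₂ F z

/-- `F̃(z) = z · ∇F(z) - (2 - μ) F(z)`. -/
def Ftilde (μ : ℝ) (F : ℝ × ℝ → ℝ) (z : ℝ × ℝ) : ℝ := radial F z - (2 - μ) * F z

/-- The filter `|z| → ∞` on the plane. -/
def lenAtTop : Filter (ℝ × ℝ) := Filter.comap len Filter.atTop

/-- The filter `|z₁|, |z₂| → ∞` (both coordinates tend to infinity in absolute value). -/
def bothAtTop : Filter (ℝ × ℝ) :=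
  (Filter.comap (fun s : ℝ => |s|) Filter.atTop) ×ˢ (Filter.comap (fun s : ℝ => |s|) Filter.atTop)

/-- Both partial derivatives are continuous, and `o(|z|^κ)` at the origin for some
`κ > 2 - μ`. -/
def CondSmall (μ : ℝ) (F : ℝ × ℝ → ℝ) : Prop :=
  ContDiff ℝ 1 F ∧
    ∃ κ : ℝ, 2 - μ < κ ∧
      Filter.Tendsto (fun z => |partial₁ F z| / len z ^ κ) (nhdsWithin 0 {0}ᶜ) (nhds 0) ∧
      Filter.Tendsto (fun z => |partial₂ F z| / len z ^ κ) (nhdsWithin 0 {0}ᶜ) (nhds 0)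

/-- Exponential critical growth of the partial derivatives, with critical exponent `π`.
The lower half is only asked for as both `|z₁|` and `|z₂|` tend to infinity: no positive `F` can
satisfy it as `|z| → ∞` in all directions, since `∂₁F` would then have a constant sign far away and
`F` would tend to `-∞` along a horizontal line. -/
def CondCritical (F : ℝ × ℝ → ℝ) : Prop :=
  (∀ α : ℝ, Real.pi < α →
    Filter.Tendsto (fun z => |partial₁ F z| / Real.exp (α * lenSq z)) lenAtTop (nhds 0) ∧
    Filter.Tendsto (fun z => |partial₂ F z| / Real.exp (α * lenSq z)) lenAtTop (nhds 0)) ∧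
  (∀ α : ℝ, 0 < α → α < Real.pi →
    Filter.Tendsto (fun z => |partial₁ F z| / Real.exp (α * lenSq z)) bothAtTop Filter.atTop ∧
    Filter.Tendsto (fun z => |partial₂ F z| / Real.exp (α * lenSq z)) bothAtTop Filter.atTop)

/-- The Ambrosetti–Rabinowitz type condition. -/
def CondAR (μ : ℝ) (F : ℝ × ℝ → ℝ) : Prop :=
  ∃ θ : ℝ, 3 - μ < θ ∧ ∀ z : ℝ × ℝ, z ≠ 0 → 0 < θ * F z ∧ θ * F z ≤ radial F z

/-- `liminf F(z) [z · ∇F(z)] / e^{2π|z|²} ≥ β₀ > 0` as `|z₁|, |z₂| → ∞`; the lower limit is taken in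
the extended reals, since it may be `+∞`. -/
def CondLower (F : ℝ × ℝ → ℝ) : Prop :=
  ∃ β₀ : ℝ, 0 < β₀ ∧
    (β₀ : EReal) ≤ Filter.liminf
      (fun z => ((F z * radial F z / Real.exp (2 * Real.pi * lenSq z) : ℝ) : EReal)) bothAtTop

/-! ### The space `H^{1/2}(ℝ)` and the functionals -/

/-- The integrand of the squared Gagliardo seminorm. -/
def gagliardo (u : ℝ → ℝ) (p : ℝ × ℝ) : ℝ := (u p.1 - u p.2) ^ 2 / (p.1 - p.2) ^ 2

/-- `u ∈ H^{1/2}(ℝ)`. -/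
def MemHhalf (u : ℝ → ℝ) : Prop :=
  MeasureTheory.MemLp u 2 MeasureTheory.volume ∧
    MeasureTheory.Integrable (gagliardo u) MeasureTheory.volume

/-- `‖(-Δ)^{1/4} u‖₂² = (1/2π) ∫∫ |u(x) - u(y)|² / |x - y|² dx dy`. -/
def energy (u : ℝ → ℝ) : ℝ := 1 / (2 * Real.pi) * ∫ p : ℝ × ℝ, gagliardo u p

/-- The convolution `(I_μ * g)(x)` with `I_μ(x) = 1 / |x|^μ`. -/
def rieszConv (μ : ℝ) (g : ℝ → ℝ) (x : ℝ) : ℝ := ∫ y : ℝ, 1 / |x - y| ^ μ * g y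

/-- The energy functional `𝒥(u, v)`. -/
def J (μ : ℝ) (F : ℝ × ℝ → ℝ) (u v : ℝ → ℝ) : ℝ :=
  1 / 2 * energy u + 1 / 2 * energy v -
    1 / 2 * ∫ x : ℝ, rieszConv μ (fun y => F (u y, v y)) x * F (u x, v x)

/-- The Pohozaev functional `P(u, v)`. -/
def P (μ : ℝ) (F : ℝ × ℝ → ℝ) (u v : ℝ → ℝ) : ℝ :=
  energy u + energy v -
    ∫ x : ℝ, rieszConv μ (fun y => F (u y, v y)) x * Ftilde μ F (u x, v x)

/-- The `L²`-sphere `S(c)` in `H^{1/2}(ℝ)`. -/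
def sphere (c : ℝ) : Set (ℝ → ℝ) := {u | MemHhalf u ∧ ∫ x : ℝ, u x ^ 2 = c ^ 2}

/-- The Pohozaev manifold `𝒫(a, b)`. -/
def pohozaev (μ : ℝ) (F : ℝ × ℝ → ℝ) (a b : ℝ) : Set ((ℝ → ℝ) × (ℝ → ℝ)) :=
  {w | w.1 ∈ sphere a ∧ w.2 ∈ sphere b ∧ P μ F w.1 w.2 = 0}

/-- The values of `𝒥` on the Pohozaev manifold. -/
def levels (μ : ℝ) (F : ℝ × ℝ → ℝ) (a b : ℝ) : Set ℝ :=
  (fun w => J μ F w.1 w.2) '' pohozaev μ F a b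

/-- The ground state level `m(a, b) = inf_{𝒫(a, b)} 𝒥`. -/
def groundLevel (μ : ℝ) (F : ℝ × ℝ → ℝ) (a b : ℝ) : ℝ := sInf (levels μ F a b)

/-! ### The test functions -/

/-- The Moser type function `ϖ_n`. -/
def moser (n : ℕ) (x : ℝ) : ℝ :=
  1 / Real.sqrt Real.pi *
    (if |x| < 1 / (n : ℝ) then Real.sqrt (Real.log n)
     else if |x| ≤ 1 then Real.log (1 / |x|) / Real.sqrt (Real.log n)
     else 0)

/-- `ω_n^c = c ϖ_n / ‖ϖ_n‖₂`. -/
def normMoser (n : ℕ) (c : ℝ) (x : ℝ) : ℝ :=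
  c * moser n x / Real.sqrt (∫ y : ℝ, moser n y ^ 2)

/-- `Φ_n(t) = 𝒥(t ω_n^a(t² ·), t ω_n^b(t² ·))`. -/
def fibre (μ : ℝ) (F : ℝ × ℝ → ℝ) (a b : ℝ) (n : ℕ) (t : ℝ) : ℝ :=
  J μ F (fun x => t * normMoser n a (t ^ 2 * x)) (fun x => t * normMoser n b (t ^ 2 * x))

end Choquard

end

/-!
The energy is invariant under dilations and `(t ω_n^a(t²·), t ω_n^b(t²·))` takes its values on the
ray through `(a, b)`, so along the fibre everything is a function of one variable: with
`q = ϖ_n / ‖ϖ_n‖₂`, `A = a² + b²`, `f(r) = F(ra, rb)` and `g(r) = F̃(ra, rb)`,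
`Φ_n(t) = t² A E / 2 - t^{2μ - 4} D(t) / 2`, where `E` is the energy of `q` and `D(t)` the Riesz
double integral of `f(t q)` with itself, and `P` is given by a similar formula (`fibreJ`, `fibreP`).
The profile `q` being bounded with compact support, all these integrals converge and are continuous
in `t`; growth of order `> 3 - μ` at both ends makes `Φ_n` and `P` positive for small `t` and
nonpositive for large `t`. This gives the maximum and, by the intermediate value theorem, a point
of the Pohozaev manifold on the fibre (`exists_isMaxOn_fibreJ_and_fibreP_eq_zero`).

The strict inequality needs two facts.
* `energy_moser_le`: `‖(-Δ)^{1/4} ϖ_n‖₂² ≤ 1`. Substituting `y = x r` in the Gagliardo integral of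
  the truncated logarithm separates the variables: the integral in `x` is at most `2 L log² |r|`,
  and `∫₀¹ log² r ((1 - r)⁻² + (1 + r)⁻²) dr = π² / 2` by a series expansion.
* `ray_large`: integrating the lower bound on `F (z · ∇F)` along the ray gives
  `f(r)² ≥ c e^{2πA r²} / r²` for large `r`.

Put `S = t² A / ‖ϖ_n‖₂²`. Then `Φ_n(t) ≤ S / 2`, so only `S ≥ (2 - μ) / 2` matters. There the plateau
`|x| < 1/n` alone makes `t^{2μ - 4} D(t)` at least of order
`(log n)^{1 - μ} n^{2S - (2 - μ)} / S^{3 - μ}`, which for large `n` exceeds `2 S` whatever `S` is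
(`fibreJ_lt`). This is where `‖ϖ_n‖₂² = O(1 / log n)` is used.

On the whole Pohozaev manifold `𝒥 ≥ 0` since `F̃ ≥ F` (`J_nonneg_of_mem_pohozaev`), and the level is
bounded by the value of `𝒥` at the point found on the fibre.
-/

noncomputable section

namespace Choquard

open MeasureTheory Set Filter Topology

/-! ### Two changes of variables and a logarithmic integral -/

lemma lintegral_fold (h : ℝ → ENNReal) (hm : Measurable h) :
    ∫⁻ x, h x = ∫⁻ x in Ioi (0 : ℝ), (h x + h (-x)) := by
  have h1 : ∫⁻ x in Iio (0 : ℝ), h x = ∫⁻ x in Ioi (0 : ℝ), h (-x) := by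
    have := (Measure.measurePreserving_neg (volume : Measure ℝ)).setLIntegral_comp_preimage_emb
      (MeasurableEquiv.neg ℝ).measurableEmbedding h (Iio 0)
    rw [← this]
    congr 2
    ext x; simp
  rw [lintegral_add_left hm, ← h1, ← lintegral_add_compl h (measurableSet_Ioi (a := (0 : ℝ))),
    compl_Ioi, setLIntegral_congr Iio_ae_eq_Iic]

lemma lintegral_comp_mul_left_of_ne_zero (h : ℝ → ENNReal) (hm : Measurable h) {x : ℝ}
    (hx : x ≠ 0) : ∫⁻ y, h y = ENNReal.ofReal |x| * ∫⁻ r, h (x * r) := by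
  have h1 := lintegral_map (μ := volume) hm (measurable_const_mul x)
  rw [← h1, Real.map_volume_mul_left hx, lintegral_smul_measure, smul_eq_mul, ← mul_assoc,
    ← ENNReal.ofReal_mul (abs_nonneg _), abs_inv, mul_inv_cancel₀ (abs_ne_zero.2 hx)]
  simp

lemma lintegral_inv_Ioc {α β : ℝ} (hα : 0 < α) (hαβ : α ≤ β) :
    ∫⁻ x in Ioc α β, ENNReal.ofReal (1 / x) = ENNReal.ofReal (Real.log (β / α)) := by
  have hi : IntervalIntegrable (fun x : ℝ => 1 / x) volume α β := by
    apply intervalIntegral.intervalIntegrable_one_div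
    · intro x hx
      rw [uIcc_of_le hαβ] at hx
      exact (hα.trans_le hx.1).ne'
    · fun_prop
  rw [← ofReal_integral_eq_lintegral_ofReal, ← intervalIntegral.integral_of_le hαβ,
    integral_one_div_of_pos hα (hα.trans_le hαβ)]
  · exact (intervalIntegrable_iff_integrableOn_Ioc_of_le hαβ).1 hi
  · filter_upwards [ae_restrict_mem measurableSet_Ioc] with x hx
    have := hα.trans hx.1
    positivity

/-- The measure `dx / |x|` is invariant under dilations: the shell `e^{-s} < |x| ≤ e^{ρ - s}` has
mass `2ρ`, whatever `s` is. -/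
lemma lintegral_log_shell (s : ℝ) {ρ : ℝ} (hρ : 0 < ρ) :
    ∫⁻ x : ℝ, ENNReal.ofReal (1 / |x|) *
      (Ioc (-Real.log |x|) (-Real.log |x| + ρ)).indicator 1 s ≤ ENNReal.ofReal (2 * ρ) := by
  have hm : Measurable fun x : ℝ => ENNReal.ofReal (1 / |x|) *
      (Ioc (-Real.log |x|) (-Real.log |x| + ρ)).indicator (1 : ℝ → ENNReal) s := by
    apply Measurable.mul (by fun_prop)
    have : (fun x : ℝ => (Ioc (-Real.log |x|) (-Real.log |x| + ρ)).indicator (1 : ℝ → ENNReal) s)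
        = ({x : ℝ | -Real.log |x| < s} ∩ {x : ℝ | s ≤ -Real.log |x| + ρ}).indicator 1 := by
      ext x
      simp only [indicator, mem_Ioc, mem_inter_iff, mem_ofPred_eq, Pi.one_apply]
    rw [this]
    refine measurable_one.indicator (MeasurableSet.inter ?_ ?_)
    · exact measurableSet_lt (by fun_prop) (by fun_prop)
    · exact measurableSet_le (by fun_prop) (by fun_prop)
  rw [lintegral_fold _ hm]
  have key : ∀ x ∈ Ioi (0 : ℝ), ENNReal.ofReal (1 / |x|) *
      (Ioc (-Real.log |x|) (-Real.log |x| + ρ)).indicator (1 : ℝ → ENNReal) s =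
      (Ioc (Real.exp (-s)) (Real.exp (ρ - s))).indicator (fun x => ENNReal.ofReal (1 / x)) x := by
    intro x hx
    have hx : 0 < x := hx
    rw [abs_of_pos hx]
    have : s ∈ Ioc (-Real.log x) (-Real.log x + ρ) ↔
        x ∈ Ioc (Real.exp (-s)) (Real.exp (ρ - s)) := by
      rw [mem_Ioc, mem_Ioc, ← Real.lt_log_iff_exp_lt hx, ← Real.log_le_iff_le_exp hx]
      constructor <;> rintro ⟨h1, h2⟩ <;> constructor <;> linarith
    by_cases h : s ∈ Ioc (-Real.log x) (-Real.log x + ρ)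
    · rw [indicator_of_mem h, indicator_of_mem (this.1 h)]; simp
    · rw [indicator_of_notMem h, indicator_of_notMem (fun h' => h (this.2 h'))]; simp
  have e1 : ∫⁻ x in Ioi (0 : ℝ), ENNReal.ofReal (1 / |x|) *
      (Ioc (-Real.log |x|) (-Real.log |x| + ρ)).indicator (1 : ℝ → ENNReal) s ≤
      ENNReal.ofReal ρ := by
    rw [setLIntegral_congr_fun measurableSet_Ioi key]
    refine (setLIntegral_le_lintegral _ _).trans ?_
    rw [lintegral_indicator measurableSet_Ioc, lintegral_inv_Ioc (Real.exp_pos _)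
      (Real.exp_le_exp.2 (by linarith)), ← Real.exp_sub, Real.log_exp]
    apply ENNReal.ofReal_le_ofReal
    linarith
  simp only [abs_neg]
  rw [lintegral_add_left hm, two_mul, ENNReal.ofReal_add hρ.le hρ.le]
  exact add_le_add e1 e1

lemma hasDerivAt_pow_mul_log_sq (m : ℕ) {x : ℝ} (hx : 0 < x) :
    HasDerivAt (fun x : ℝ => x ^ m * (x * Real.log x ^ 2 / (m + 1)
      - 2 * (x * Real.log x) / (m + 1) ^ 2 + 2 * x / (m + 1) ^ 3))
      (Real.log x ^ 2 * x ^ m) x := by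
  have hm : (m : ℝ) + 1 ≠ 0 := by positivity
  have hl := Real.hasDerivAt_log hx.ne'
  have hid := hasDerivAt_id' x
  have h1 : HasDerivAt (fun x : ℝ => x ^ (m + 1) * (Real.log x ^ 2 / (m + 1)
      - 2 * Real.log x / (m + 1) ^ 2 + 2 / (m + 1) ^ 3)) (Real.log x ^ 2 * x ^ m) x := by
    have h2 := (hasDerivAt_pow (m + 1) x).mul ((((hl.pow 2).div_const ((m : ℝ) + 1)).sub
      ((hl.const_mul 2).div_const (((m : ℝ) + 1) ^ 2))).add_const (2 / ((m : ℝ) + 1) ^ 3))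
    convert! h2 using 1
    simp only [Pi.pow_apply, Pi.sub_apply, Nat.add_sub_cancel]
    push_cast
    field_simp
    ring
  convert! h1 using 1
  ext y
  ring

lemma continuous_mul_log_sq : ContinuousOn (fun x : ℝ => x * Real.log x ^ 2) (Ici 0) := by
  have h : Continuous fun x : ℝ => 4 * (Real.sqrt x * Real.log (Real.sqrt x)) ^ 2 := by
    have := Real.continuous_mul_log.comp Real.continuous_sqrt
    exact continuous_const.mul (this.pow 2)
  refine h.continuousOn.congr ?_
  intro x hx
  have hx : 0 ≤ x := hx
  simp only
  rw [Real.log_sqrt hx, mul_pow, Real.sq_sqrt hx]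
  ring

lemma lintegral_log_sq_mul_pow (m : ℕ) :
    ∫⁻ x in Ioc (0 : ℝ) 1, ENNReal.ofReal (Real.log x ^ 2 * x ^ m) =
      ENNReal.ofReal (2 / (m + 1) ^ 3) := by
  have hc : ContinuousOn (fun x : ℝ => x ^ m * (x * Real.log x ^ 2 / (m + 1)
      - 2 * (x * Real.log x) / (m + 1) ^ 2 + 2 * x / (m + 1) ^ 3)) (Icc 0 1) := by
    have h1 := continuous_mul_log_sq.mono (fun x (hx : x ∈ Icc (0 : ℝ) 1) => hx.1)
    have h2 : ContinuousOn (fun x : ℝ => x * Real.log x) (Icc 0 1) :=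
      Real.continuous_mul_log.continuousOn
    fun_prop
  have hd : ∀ x ∈ Ioo (0 : ℝ) 1, HasDerivAt (fun x : ℝ => x ^ m * (x * Real.log x ^ 2 / (m + 1)
      - 2 * (x * Real.log x) / (m + 1) ^ 2 + 2 * x / (m + 1) ^ 3))
      (Real.log x ^ 2 * x ^ m) x := fun x hx => hasDerivAt_pow_mul_log_sq m hx.1
  have hi := intervalIntegral.integrableOn_deriv_of_nonneg hc hd (fun x hx => by
    have := hx.1
    positivity)
  have hint := intervalIntegral.integral_eq_sub_of_hasDerivAt_of_le zero_le_one hc hd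
    ((intervalIntegrable_iff_integrableOn_Ioc_of_le zero_le_one).2 hi)
  rw [intervalIntegral.integral_of_le zero_le_one] at hint
  rw [← ofReal_integral_eq_lintegral_ofReal hi, hint]
  · congr 1
    simp
  · filter_upwards [ae_restrict_mem measurableSet_Ioc] with x hx
    have := hx.1
    positivity

lemma hasSum_inv_odd_sq :
    HasSum (fun j : ℕ => 1 / (2 * (j : ℝ) + 1) ^ 2) (Real.pi ^ 2 / 8) := by
  have h := hasSum_zeta_two
  have he : HasSum (fun j : ℕ => 1 / (((2 * j : ℕ) : ℝ)) ^ 2) (Real.pi ^ 2 / 24) := by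
    convert! h.mul_left (1 / 4) using 1
    · ext j
      push_cast
      rw [mul_pow, one_div_mul_one_div]
      norm_num
    · ring
  have ho : Summable (fun j : ℕ => 1 / (((2 * j + 1 : ℕ) : ℝ)) ^ 2) :=
    h.summable.comp_injective (i := fun j : ℕ => 2 * j + 1) (fun a b hab => by simpa using hab)
  have h2 := (HasSum.even_add_odd (f := fun n : ℕ => 1 / (n : ℝ) ^ 2) he ho.hasSum).unique h
  have h3 := ho.hasSum
  rw [show ∑' j : ℕ, 1 / (((2 * j + 1 : ℕ) : ℝ)) ^ 2 = Real.pi ^ 2 / 8 by linarith] at h3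
  simpa using h3

lemma hasSum_odd_mul_pow {r : ℝ} (h0 : 0 < r) (h1 : r < 1) :
    HasSum (fun j : ℕ => 2 * (2 * (j : ℝ) + 1) * r ^ (2 * j))
      (1 / (1 - r) ^ 2 + 1 / (1 + r) ^ 2) := by
  have hq : ‖r ^ 2‖ < 1 := by
    rw [Real.norm_eq_abs, abs_of_nonneg (by positivity)]
    exact pow_lt_one₀ h0.le h1 two_ne_zero
  have h := ((hasSum_coe_mul_geometric_of_norm_lt_one hq).mul_left 4).add
    ((hasSum_geometric_of_norm_lt_one hq).mul_left 2)
  convert! h using 1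
  · ext j
    rw [pow_mul]; ring
  · have e1 : (1 : ℝ) - r ≠ 0 := by linarith
    have e2 : (1 : ℝ) + r ≠ 0 := by linarith
    have e3 : 1 - r ^ 2 = (1 - r) * (1 + r) := by ring
    rw [e3]
    field_simp
    ring

/-- The value of the sharp constant: expand the kernel into a geometric series, integrate
`log² r · r^{2j}` term by term and sum `1 / (2j + 1)²`. -/
lemma lintegral_log_sq_kernel :
    ∫⁻ r in Ioo (0 : ℝ) 1,
      ENNReal.ofReal (Real.log r ^ 2 * (1 / (1 - r) ^ 2 + 1 / (1 + r) ^ 2)) =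
      ENNReal.ofReal (Real.pi ^ 2 / 2) := by
  have e : ∀ r ∈ Ioo (0 : ℝ) 1,
      ENNReal.ofReal (Real.log r ^ 2 * (1 / (1 - r) ^ 2 + 1 / (1 + r) ^ 2)) =
      ∑' j : ℕ, ENNReal.ofReal (2 * (2 * (j : ℝ) + 1)) *
        ENNReal.ofReal (Real.log r ^ 2 * r ^ (2 * j)) := by
    intro r hr
    have hs := (hasSum_odd_mul_pow hr.1 hr.2).mul_left (Real.log r ^ 2)
    have hr0 := hr.1
    rw [← hs.tsum_eq, ENNReal.ofReal_tsum_of_nonneg (fun j => by positivity) hs.summable]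
    congr 1
    ext j
    rw [← ENNReal.ofReal_mul (by positivity)]
    congr 1
    ring
  rw [setLIntegral_congr_fun measurableSet_Ioo e, lintegral_tsum (fun j => by fun_prop)]
  have e2 : ∀ j : ℕ, ∫⁻ r in Ioo (0 : ℝ) 1, ENNReal.ofReal (2 * (2 * (j : ℝ) + 1)) *
      ENNReal.ofReal (Real.log r ^ 2 * r ^ (2 * j)) =
      ENNReal.ofReal (4 * (1 / (2 * (j : ℝ) + 1) ^ 2)) := by
    intro j
    rw [lintegral_const_mul _ (by fun_prop), setLIntegral_congr Ioo_ae_eq_Ioc,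
      lintegral_log_sq_mul_pow, ← ENNReal.ofReal_mul (by positivity)]
    congr 1
    push_cast
    field_simp
    ring
  simp_rw [e2]
  have hs := hasSum_inv_odd_sq.mul_left 4
  rw [← ENNReal.ofReal_tsum_of_nonneg (fun j => by positivity) hs.summable, hs.tsum_eq]
  congr 1
  ring

/-! ### The Gagliardo seminorm of a truncated logarithm -/

/-- The truncated logarithm `min(L, max(0, log(1/|x|)))`. It is the Moser function without its
normalising factor, except at `x = 0`, where `Real.log 0 = 0` makes it vanish. -/
def truncLog (L x : ℝ) : ℝ := max 0 (min L (-Real.log |x|))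

@[fun_prop]
lemma measurable_truncLog (L : ℝ) : Measurable (truncLog L) := by
  unfold truncLog
  fun_prop

lemma ofReal_clamp_sub_le (L p ρ : ℝ) (hρ : 0 < ρ) :
    ENNReal.ofReal (max 0 (min L (p + ρ)) - max 0 (min L p)) ≤
      ∫⁻ s in Ioc 0 L, (Ioc p (p + ρ)).indicator 1 s := by
  rw [lintegral_indicator_one measurableSet_Ioc, Measure.restrict_apply measurableSet_Ioc,
    Ioc_inter_Ioc, Real.volume_Ioc]
  rcases le_or_gt (max 0 (min L (p + ρ)) - max 0 (min L p)) 0 with h | h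
  · rw [ENNReal.ofReal_of_nonpos h]; exact zero_le
  · apply ENNReal.ofReal_le_ofReal
    grind

lemma clamp_sub_sq_le (L p ρ : ℝ) (hρ : 0 < ρ) :
    (max 0 (min L p) - max 0 (min L (p + ρ))) ^ 2 ≤
      ρ * (max 0 (min L (p + ρ)) - max 0 (min L p)) := by
  have h1 : 0 ≤ max 0 (min L (p + ρ)) - max 0 (min L p) := by grind
  have h2 : max 0 (min L (p + ρ)) - max 0 (min L p) ≤ ρ := by grind
  nlinarith

/-- In the variable `p = log(1/|x|)` the truncated logarithm is a clamp `χ`, for which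
`∫ (χ(p + ρ) - χ(p))² dp ≤ ρ ∫ (χ(p + ρ) - χ(p)) dp = L ρ²`; the last integral is computed by the
layer-cake formula. -/
lemma lintegral_truncLog_dilation_le (L : ℝ) {r : ℝ} (hr0 : r ≠ 0) (hr1 : |r| < 1) :
    ∫⁻ x : ℝ, ENNReal.ofReal ((truncLog L x - truncLog L (x * r)) ^ 2 / |x|) ≤
      ENNReal.ofReal (2 * L * Real.log |r| ^ 2) := by
  set ρ := -Real.log |r| with hρdef
  have hρ : 0 < ρ := by
    have := Real.log_neg (abs_pos.2 hr0) hr1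
    linarith
  have hpt : ∀ x : ℝ, ENNReal.ofReal ((truncLog L x - truncLog L (x * r)) ^ 2 / |x|) ≤
      ENNReal.ofReal ρ * ∫⁻ s in Ioc 0 L, ENNReal.ofReal (1 / |x|) *
        (Ioc (-Real.log |x|) (-Real.log |x| + ρ)).indicator 1 s := by
    intro x
    rcases eq_or_ne x 0 with rfl | hx
    · simp
    have hx' : 0 < |x| := abs_pos.2 hx
    have e : truncLog L (x * r) = max 0 (min L (-Real.log |x| + ρ)) := by
      rw [truncLog, abs_mul, Real.log_mul hx'.ne' (abs_ne_zero.2 hr0), hρdef]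
      congr 2
      ring
    rw [lintegral_const_mul' _ _ ENNReal.ofReal_ne_top]
    refine le_trans ?_ (mul_le_mul_right (mul_le_mul_right
      (ofReal_clamp_sub_le L (-Real.log |x|) ρ hρ) _) _)
    rw [← ENNReal.ofReal_mul (by positivity), ← ENNReal.ofReal_mul hρ.le]
    apply ENNReal.ofReal_le_ofReal
    rw [e, truncLog]
    have := clamp_sub_sq_le L (-Real.log |x|) ρ hρ
    calc _ ≤ ρ * (max 0 (min L (-Real.log |x| + ρ)) - max 0 (min L (-Real.log |x|))) / |x| := by
          gcongr
      _ = _ := by ring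
  have hS : MeasurableSet {p : ℝ × ℝ | -Real.log |p.1| < p.2 ∧ p.2 ≤ -Real.log |p.1| + ρ} := by
    exact (measurableSet_lt (f := fun p : ℝ × ℝ => -Real.log |p.1|) (g := Prod.snd)
      (by fun_prop) (by fun_prop)).inter (measurableSet_le (f := Prod.snd)
      (g := fun p : ℝ × ℝ => -Real.log |p.1| + ρ) (by fun_prop) (by fun_prop))
  calc _ ≤ ∫⁻ x : ℝ, ENNReal.ofReal ρ * ∫⁻ s in Ioc 0 L, ENNReal.ofReal (1 / |x|) *
        (Ioc (-Real.log |x|) (-Real.log |x| + ρ)).indicator 1 s := lintegral_mono hpt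
    _ = ENNReal.ofReal ρ * ∫⁻ s in Ioc 0 L, ∫⁻ x : ℝ, ENNReal.ofReal (1 / |x|) *
        (Ioc (-Real.log |x|) (-Real.log |x| + ρ)).indicator 1 s := by
      rw [lintegral_const_mul' _ _ ENNReal.ofReal_ne_top, lintegral_lintegral_swap]
      apply Measurable.aemeasurable
      apply Measurable.mul
      · fun_prop
      · convert! (measurable_one (α := ENNReal)).indicator hS using 1
    _ ≤ ENNReal.ofReal ρ * ∫⁻ s in Ioc 0 L, ENNReal.ofReal (2 * ρ) := by
      gcongr with s
      exact lintegral_log_shell s hρ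
    _ = ENNReal.ofReal (2 * L * Real.log |r| ^ 2) := by
      rw [setLIntegral_const, Real.volume_Ioc, ← ENNReal.ofReal_mul (by positivity),
        ← ENNReal.ofReal_mul hρ.le, hρdef]
      congr 1
      ring

lemma lintegral_gagliardo_eq_two_mul (u : ℝ → ℝ) (hu : Measurable u)
    (heven : ∀ x, u (-x) = u x) :
    ∫⁻ p : ℝ × ℝ, ENNReal.ofReal (gagliardo u p) =
      2 * ∫⁻ x, ∫⁻ y, {p : ℝ × ℝ | |p.2| < |p.1|}.indicator
        (fun p => ENNReal.ofReal (gagliardo u p)) (x, y) := by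
  have hg : Measurable fun p : ℝ × ℝ => ENNReal.ofReal (gagliardo u p) := by
    unfold gagliardo
    fun_prop
  have hS : MeasurableSet {p : ℝ × ℝ | |p.2| < |p.1|} :=
    measurableSet_lt (by fun_prop) (by fun_prop)
  set f := {p : ℝ × ℝ | |p.2| < |p.1|}.indicator (fun p => ENNReal.ofReal (gagliardo u p)) with hf
  have hfm : Measurable f := hg.indicator hS
  have e : ∀ p : ℝ × ℝ, ENNReal.ofReal (gagliardo u p) = f p + f p.swap := by
    rintro ⟨x, y⟩
    have hsymm : gagliardo u (y, x) = gagliardo u (x, y) := by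
      simp only [gagliardo]
      rw [← neg_sub (u x), ← neg_sub x, neg_sq, neg_sq]
    simp only [hf, Prod.swap_prod_mk, indicator, mem_ofPred_eq, hsymm]
    rcases lt_trichotomy |x| |y| with h | h | h
    · simp [h, h.not_gt]
    · -- on the diagonals `|x| = |y|` the integrand vanishes, `u` being even
      have : u x = u y := by
        rcases abs_eq_abs.1 h with h | h
        · rw [h]
        · rw [h, heven]
      simp [gagliardo, this, h]
    · simp [h, h.not_gt]
  simp_rw [e]
  rw [lintegral_add_left hfm, Measure.volume_eq_prod, lintegral_prod_swap, ← two_mul,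
    lintegral_prod _ hfm.aemeasurable]

/-- The truncated logarithm has Gagliardo seminorm at most `2π² L`; substituting `y = x r`
decouples the two variables. -/
lemma lintegral_gagliardo_truncLog_le (L : ℝ) (hL : 0 ≤ L) :
    ∫⁻ p : ℝ × ℝ, ENNReal.ofReal (gagliardo (truncLog L) p) ≤
      ENNReal.ofReal (2 * Real.pi ^ 2 * L) := by
  rw [lintegral_gagliardo_eq_two_mul _ (measurable_truncLog L) (fun x => by simp [truncLog])]
  set K : ℝ → ENNReal := (Ioo (-1 : ℝ) 1).indicator fun r => ENNReal.ofReal (1 / (1 - r) ^ 2)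
    with hK
  have hKm : Measurable K := Measurable.indicator (by fun_prop) measurableSet_Ioo
  have hS : MeasurableSet {p : ℝ × ℝ | |p.2| < |p.1|} :=
    measurableSet_lt (by fun_prop) (by fun_prop)
  have hg : Measurable fun p : ℝ × ℝ => ENNReal.ofReal (gagliardo (truncLog L) p) := by
    unfold gagliardo
    fun_prop
  have hfm := hg.indicator hS
  have step1 : ∀ x : ℝ, x ≠ 0 → ∫⁻ y, {p : ℝ × ℝ | |p.2| < |p.1|}.indicator
        (fun p => ENNReal.ofReal (gagliardo (truncLog L) p)) (x, y) =
      ∫⁻ r, K r * ENNReal.ofReal ((truncLog L x - truncLog L (x * r)) ^ 2 / |x|) := by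
    intro x hx
    have hx' : 0 < |x| := abs_pos.2 hx
    have hmx := hfm.comp (measurable_prodMk_left (x := x))
    rw [lintegral_comp_mul_left_of_ne_zero
      (fun y => {p : ℝ × ℝ | |p.2| < |p.1|}.indicator
        (fun p => ENNReal.ofReal (gagliardo (truncLog L) p)) (x, y)) hmx hx,
      ← lintegral_const_mul' _ _ ENNReal.ofReal_ne_top]
    congr 1
    ext r
    have hiff : |x * r| < |x| ↔ r ∈ Ioo (-1 : ℝ) 1 := by
      rw [abs_mul, mul_lt_iff_lt_one_right hx', abs_lt, mem_Ioo]
    by_cases h : r ∈ Ioo (-1 : ℝ) 1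
    · rw [hK, indicator_of_mem h, indicator_of_mem (show (x, x * r) ∈ _ from hiff.2 h),
        ← ENNReal.ofReal_mul (abs_nonneg _), ← ENNReal.ofReal_mul (by positivity)]
      congr 1
      have : (1 - r) ≠ 0 := by linarith [h.2]
      have e : (x - x * r) ^ 2 = |x| ^ 2 * (1 - r) ^ 2 := by rw [sq_abs]; ring
      simp only [gagliardo]
      rw [e]
      field_simp
    · rw [hK, indicator_of_notMem h,
        indicator_of_notMem (show (x, x * r) ∉ _ from fun h' => h (hiff.1 h'))]
      simp
  have step2 : ∫⁻ x, ∫⁻ y, {p : ℝ × ℝ | |p.2| < |p.1|}.indicator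
        (fun p => ENNReal.ofReal (gagliardo (truncLog L) p)) (x, y) =
      ∫⁻ r, K r * ∫⁻ x, ENNReal.ofReal ((truncLog L x - truncLog L (x * r)) ^ 2 / |x|) := by
    have h0 : ∀ᵐ x : ℝ, x ≠ 0 := by simp [ae_iff]
    rw [lintegral_congr_ae (h0.mono step1), lintegral_lintegral_swap]
    · congr 1
      ext r
      rw [lintegral_const_mul]
      fun_prop
    · apply Measurable.aemeasurable
      apply Measurable.mul
      · exact hKm.comp measurable_snd
      · fun_prop
  have step3 : ∫⁻ r, K r * ∫⁻ x, ENNReal.ofReal ((truncLog L x - truncLog L (x * r)) ^ 2 / |x|) ≤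
      ∫⁻ r, K r * ENNReal.ofReal (2 * L * Real.log |r| ^ 2) := by
    apply lintegral_mono_ae
    have h0 : ∀ᵐ x : ℝ, x ≠ 0 := by simp [ae_iff]
    filter_upwards [h0] with r hr
    by_cases h : r ∈ Ioo (-1 : ℝ) 1
    · gcongr
      exact lintegral_truncLog_dilation_le L hr (abs_lt.2 h)
    · simp [hK, indicator_of_notMem h]
  have step4 : ∫⁻ r, K r * ENNReal.ofReal (2 * L * Real.log |r| ^ 2) =
      ENNReal.ofReal (2 * L) * ENNReal.ofReal (Real.pi ^ 2 / 2) := by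
    rw [lintegral_fold (fun r => K r * ENNReal.ofReal (2 * L * Real.log |r| ^ 2))
        (by fun_prop), ← lintegral_log_sq_kernel,
      ← lintegral_const_mul' _ _ ENNReal.ofReal_ne_top,
      ← lintegral_indicator measurableSet_Ioi, ← lintegral_indicator measurableSet_Ioo]
    congr 1
    ext r
    by_cases h : r ∈ Ioo (0 : ℝ) 1
    · have h1 : r ∈ Ioo (-1 : ℝ) 1 := ⟨by linarith [h.1], h.2⟩
      have h2 : -r ∈ Ioo (-1 : ℝ) 1 := ⟨by linarith [h.2], by linarith [h.1]⟩
      rw [indicator_of_mem h, indicator_of_mem (show r ∈ Ioi (0 : ℝ) from h.1), hK,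
        indicator_of_mem h1, indicator_of_mem h2, abs_neg, ← add_mul,
        ← ENNReal.ofReal_add (by positivity) (by positivity), ← ENNReal.ofReal_mul (by positivity),
        ← ENNReal.ofReal_mul (by positivity), abs_of_pos h.1]
      congr 1
      ring
    · rw [indicator_of_notMem h]
      by_cases h0 : r ∈ Ioi (0 : ℝ)
      · have h0' : 0 < r := h0
        have hr1 : 1 ≤ r := by
          by_contra hlt
          exact h ⟨h0', not_le.1 hlt⟩
        have h1 : r ∉ Ioo (-1 : ℝ) 1 := fun h' => by linarith [h'.2]
        have h2 : -r ∉ Ioo (-1 : ℝ) 1 := fun h' => by linarith [h'.1]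
        rw [indicator_of_mem h0, hK, indicator_of_notMem h1, indicator_of_notMem h2]
        simp
      · rw [indicator_of_notMem h0]
  rw [step2]
  refine (mul_le_mul_right (step3.trans_eq step4) _).trans_eq ?_
  rw [show (2 : ENNReal) = ENNReal.ofReal 2 by simp, ← ENNReal.ofReal_mul (by positivity),
    ← ENNReal.ofReal_mul (by positivity)]
  congr 1
  ring

/-! ### The energy on `H^{1/2}(ℝ)` -/

lemma gagliardo_nonneg (u : ℝ → ℝ) (p : ℝ × ℝ) : 0 ≤ gagliardo u p := by
  unfold gagliardo
  positivity

lemma energy_nonneg (u : ℝ → ℝ) : 0 ≤ energy u := by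
  have : 0 ≤ ∫ p : ℝ × ℝ, gagliardo u p := integral_nonneg fun p => gagliardo_nonneg u p
  unfold energy
  positivity

lemma gagliardo_comp_mul (u : ℝ → ℝ) (k : ℝ) {s : ℝ} (hs : s ≠ 0) (p : ℝ × ℝ) :
    gagliardo (fun x => k * u (s * x)) p = k ^ 2 * s ^ 2 * gagliardo u (s • p) := by
  have e : (s * p.1 - s * p.2) ^ 2 = s ^ 2 * (p.1 - p.2) ^ 2 := by ring
  simp only [gagliardo, Prod.smul_fst, Prod.smul_snd, smul_eq_mul]
  rw [e, ← mul_sub, mul_pow]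
  field_simp

/-- The energy does not see dilations. -/
lemma energy_comp_mul (u : ℝ → ℝ) (k : ℝ) {s : ℝ} (hs : s ≠ 0) :
    energy (fun x => k * u (s * x)) = k ^ 2 * energy u := by
  simp only [energy, gagliardo_comp_mul u k hs]
  rw [integral_const_mul, Measure.integral_comp_smul]
  simp only [Module.finrank_prod, Module.finrank_self, smul_eq_mul, Nat.reduceAdd]
  rw [abs_of_nonneg (by positivity)]
  field_simp

lemma memHhalf_comp_mul {u : ℝ → ℝ} (hu : MemHhalf u) (k : ℝ) {s : ℝ} (hs : s ≠ 0) :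
    MemHhalf (fun x => k * u (s * x)) := by
  refine ⟨?_, ?_⟩
  · apply MemLp.const_mul
    have h1 := (hu.1.1.comp_quasiMeasurePreserving
      (Measure.quasiMeasurePreserving_smul (volume : Measure ℝ) (r := s) hs))
    have h2 := (integrable_comp_smul_iff volume (fun x => u x ^ 2) hs).2
      ((memLp_two_iff_integrable_sq hu.1.1).1 hu.1)
    exact (memLp_two_iff_integrable_sq h1).2 h2
  · have : gagliardo (fun x => k * u (s * x)) = fun p => k ^ 2 * s ^ 2 * gagliardo u (s • p) :=
      funext (gagliardo_comp_mul u k hs)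
    rw [this]
    exact ((integrable_comp_smul_iff volume (gagliardo u) hs).2 hu.2).const_mul _

/-- A function of `H^{1/2}(ℝ)` with zero energy is constant, hence zero. -/
lemma energy_pos {u : ℝ → ℝ} (hu : MemHhalf u) (h0 : ∫ x, u x ^ 2 ≠ 0) : 0 < energy u := by
  refine (energy_nonneg u).lt_of_ne' fun h => h0 ?_
  have h1 : ∫ p : ℝ × ℝ, gagliardo u p = 0 := by
    have hpi := Real.pi_pos
    rcases mul_eq_zero.1 h with h | h
    · exact absurd h (by positivity)
    · exact h
  have h2 := (integral_eq_zero_iff_of_nonneg (gagliardo_nonneg u) hu.2).1 h1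
  have h3 : ∀ᵐ p : ℝ × ℝ, u p.1 = u p.2 := by
    filter_upwards [h2] with p hp
    rcases div_eq_zero_iff.1 hp with h | h
    · exact sub_eq_zero.1 (pow_eq_zero_iff two_ne_zero |>.1 h)
    · rw [sub_eq_zero.1 (pow_eq_zero_iff two_ne_zero |>.1 h)]
  obtain ⟨x, hx⟩ := (Measure.ae_ae_of_ae_prod h3).exists
  have h4 : u =ᵐ[volume] fun _ => u x := hx.mono fun y hy => hy.symm
  have h5 : u x = 0 := by
    have := (memLp_congr_ae h4).1 hu.1
    rw [memLp_const_iff two_ne_zero ENNReal.ofNat_ne_top] at this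
    simpa using this
  have h6 : (fun y => u y ^ 2) =ᵐ[volume] fun _ => 0 := by
    filter_upwards [h4] with y hy
    rw [hy, h5]
    norm_num
  rw [integral_congr_ae h6, integral_zero]

/-! ### The Moser functions -/

lemma moser_nonneg (n : ℕ) (x : ℝ) : 0 ≤ moser n x := by
  unfold moser
  apply mul_nonneg (by positivity)
  split_ifs with h1 h2
  · positivity
  · apply div_nonneg _ (Real.sqrt_nonneg _)
    rcases eq_or_ne x 0 with rfl | hx
    · simp
    · exact Real.log_nonneg ((one_le_div (abs_pos.2 hx)).2 h2)
  · rfl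

lemma moser_eq_zero {n : ℕ} (hn : 1 ≤ n) {x : ℝ} (hx : 1 < |x|) : moser n x = 0 := by
  have h1 : (1 : ℝ) / n ≤ 1 := by
    rw [div_le_one (by positivity)]
    exact_mod_cast hn
  unfold moser
  rw [if_neg (by linarith), if_neg (by linarith), mul_zero]

lemma moser_eq_plateau {n : ℕ} {x : ℝ} (hx : |x| < 1 / n) :
    moser n x = Real.sqrt (Real.log n / Real.pi) := by
  have := Real.pi_pos
  unfold moser
  rw [if_pos hx, Real.sqrt_div' _ Real.pi_pos.le]
  ring

@[fun_prop]
lemma measurable_moser (n : ℕ) : Measurable (moser n) := by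
  unfold moser
  apply Measurable.const_mul
  apply Measurable.ite (measurableSet_lt (by fun_prop) (by fun_prop)) (by fun_prop)
  exact Measurable.ite (measurableSet_le (by fun_prop) (by fun_prop)) (by fun_prop) (by fun_prop)

lemma moser_eq_truncLog {n : ℕ} (hn : 2 ≤ n) {x : ℝ} (hx : x ≠ 0) :
    moser n x = 1 / Real.sqrt (Real.pi * Real.log n) * truncLog (Real.log n) x := by
  have hn1 : (1 : ℝ) < n := by exact_mod_cast hn
  have hn0 : (0 : ℝ) < n := by linarith
  have hL : 0 < Real.log n := Real.log_pos hn1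
  have hx' : 0 < |x| := abs_pos.2 hx
  have hs : Real.sqrt (Real.log n) * Real.sqrt (Real.log n) = Real.log n :=
    Real.mul_self_sqrt hL.le
  have hsp : 0 < Real.sqrt (Real.log n) := Real.sqrt_pos.2 hL
  have hpp : 0 < Real.sqrt Real.pi := Real.sqrt_pos.2 Real.pi_pos
  rw [Real.sqrt_mul Real.pi_pos.le]
  unfold moser truncLog
  split_ifs with h1 h2
  · have : Real.log n < -Real.log |x| := by
      rw [← Real.log_inv]
      apply Real.log_lt_log hn0
      rwa [lt_inv_comm₀ hn0 hx', ← one_div]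
    rw [min_eq_left this.le, max_eq_right hL.le]
    field_simp
    nlinarith
  · have h3 : -Real.log |x| ≤ Real.log n := by
      rw [← Real.log_inv]
      apply Real.log_le_log (by positivity)
      rw [inv_le_comm₀ hx' hn0, ← one_div]
      exact not_lt.1 h1
    have h4 : 0 ≤ -Real.log |x| := by
      have := Real.log_nonpos hx'.le h2
      linarith
    rw [min_eq_right h3, max_eq_right h4, one_div |x|, Real.log_inv]
    field_simp
  · have h4 : -Real.log |x| ≤ 0 := by
      have := Real.log_nonneg (not_le.1 h2).le
      linarith
    rw [max_eq_left (min_le_of_right_le h4), mul_zero, mul_zero]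

lemma moser_le {n : ℕ} (hn : 2 ≤ n) (x : ℝ) : moser n x ≤ Real.sqrt (Real.log n / Real.pi) := by
  have hn1 : (1 : ℝ) < n := by exact_mod_cast hn
  have hL : 0 < Real.log n := Real.log_pos hn1
  rcases eq_or_ne x 0 with rfl | hx
  · exact (moser_eq_plateau (by simp; linarith)).le
  · have hp := Real.pi_pos
    have hs : Real.sqrt (Real.log n) * Real.sqrt (Real.log n) = Real.log n :=
      Real.mul_self_sqrt hL.le
    have hsp : 0 < Real.sqrt (Real.log n) := Real.sqrt_pos.2 hL
    have hpp : 0 < Real.sqrt Real.pi := Real.sqrt_pos.2 Real.pi_pos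
    rw [moser_eq_truncLog hn hx, Real.sqrt_div' _ hp.le, Real.sqrt_mul hp.le]
    have : truncLog (Real.log n) x ≤ Real.log n := max_le hL.le (min_le_left _ _)
    calc _ ≤ 1 / (Real.sqrt Real.pi * Real.sqrt (Real.log n)) * Real.log n := by gcongr
      _ = _ := by
        field_simp
        nlinarith

lemma moser_ae_eq {n : ℕ} (hn : 2 ≤ n) : moser n =ᵐ[volume]
    fun x => 1 / Real.sqrt (Real.pi * Real.log n) * truncLog (Real.log n) x := by
  have h0 : ∀ᵐ x : ℝ, x ≠ 0 := by simp [ae_iff]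
  exact h0.mono fun x hx => moser_eq_truncLog hn hx

lemma gagliardo_congr_ae {u v : ℝ → ℝ} (h : u =ᵐ[volume] v) :
    gagliardo u =ᵐ[volume] gagliardo v := by
  have h1 := Measure.quasiMeasurePreserving_fst (μ := (volume : Measure ℝ))
    (ν := (volume : Measure ℝ)) |>.ae h
  have h2 := Measure.quasiMeasurePreserving_snd (μ := (volume : Measure ℝ))
    (ν := (volume : Measure ℝ)) |>.ae h
  filter_upwards [h1, h2] with p hp1 hp2
  simp only [gagliardo, hp1, hp2]

lemma measurable_gagliardo {u : ℝ → ℝ} (hu : Measurable u) : Measurable (gagliardo u) := by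
  unfold gagliardo
  fun_prop

lemma lintegral_gagliardo_moser_le {n : ℕ} (hn : 2 ≤ n) :
    ∫⁻ p : ℝ × ℝ, ENNReal.ofReal (gagliardo (moser n) p) ≤ ENNReal.ofReal (2 * Real.pi) := by
  have hn1 : (1 : ℝ) < n := by exact_mod_cast hn
  have hL : 0 < Real.log n := Real.log_pos hn1
  have hp := Real.pi_pos
  set k := 1 / Real.sqrt (Real.pi * Real.log n) with hk
  have hk2 : k ^ 2 = 1 / (Real.pi * Real.log n) := by
    rw [hk, div_pow, Real.sq_sqrt (by positivity), one_pow]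
  have e : ∀ᵐ p : ℝ × ℝ, ENNReal.ofReal (gagliardo (moser n) p) =
      ENNReal.ofReal (k ^ 2) * ENNReal.ofReal (gagliardo (truncLog (Real.log n)) p) := by
    filter_upwards [gagliardo_congr_ae (moser_ae_eq hn)] with p hp
    rw [hp, ← ENNReal.ofReal_mul (by positivity)]
    congr 1
    simp only [gagliardo]
    ring
  rw [lintegral_congr_ae e, lintegral_const_mul' _ _ ENNReal.ofReal_ne_top]
  refine (mul_le_mul_right (lintegral_gagliardo_truncLog_le _ hL.le) _).trans_eq ?_
  rw [← ENNReal.ofReal_mul (by positivity), hk2]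
  congr 1
  field_simp

lemma integrable_gagliardo_moser {n : ℕ} (hn : 2 ≤ n) : Integrable (gagliardo (moser n)) := by
  refine ⟨(measurable_gagliardo (measurable_moser n)).aestronglyMeasurable, ?_⟩
  rw [hasFiniteIntegral_iff_ofReal (ae_of_all _ (gagliardo_nonneg _))]
  exact (lintegral_gagliardo_moser_le hn).trans_lt ENNReal.ofReal_lt_top

lemma energy_moser_le {n : ℕ} (hn : 2 ≤ n) : energy (moser n) ≤ 1 := by
  have hp := Real.pi_pos
  have h : ∫ p : ℝ × ℝ, gagliardo (moser n) p ≤ 2 * Real.pi := by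
    rw [integral_eq_lintegral_of_nonneg_ae (ae_of_all _ (gagliardo_nonneg _))
      (measurable_gagliardo (measurable_moser n)).aestronglyMeasurable]
    exact ENNReal.toReal_le_of_le_ofReal (by positivity) (lintegral_gagliardo_moser_le hn)
  unfold energy
  calc _ ≤ 1 / (2 * Real.pi) * (2 * Real.pi) := by gcongr
    _ = 1 := by field_simp

lemma lintegral_moser_sq_le {n : ℕ} (hn : 2 ≤ n) :
    ∫⁻ x, ENNReal.ofReal (moser n x ^ 2) ≤ ENNReal.ofReal (4 / (Real.pi * Real.log n)) := by
  have hn1 : (1 : ℝ) < n := by exact_mod_cast hn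
  have hL : 0 < Real.log n := Real.log_pos hn1
  have hp := Real.pi_pos
  have hle : ∀ x : ℝ, 0 < x → ENNReal.ofReal (truncLog (Real.log n) x ^ 2) ≤
      (Ioc (0 : ℝ) 1).indicator (fun x => ENNReal.ofReal (Real.log x ^ 2 * x ^ 0)) x := by
    intro x hx
    by_cases h : x ∈ Ioc (0 : ℝ) 1
    · rw [indicator_of_mem h, pow_zero, mul_one, ← neg_sq (Real.log x)]
      apply ENNReal.ofReal_le_ofReal
      have h1 : 0 ≤ -Real.log x := by
        have := Real.log_nonpos hx.le h.2
        linarith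
      have h2 : truncLog (Real.log n) x ≤ -Real.log x := by
        rw [truncLog, abs_of_pos hx]
        exact max_le h1 (min_le_right _ _)
      exact pow_le_pow_left₀ (le_max_left _ _) h2 2
    · have h1 : 1 < x := by
        by_contra h'
        exact h ⟨hx, not_lt.1 h'⟩
      have h2 : truncLog (Real.log n) x = 0 := by
        rw [truncLog, abs_of_pos hx]
        have := Real.log_nonneg h1.le
        exact max_eq_left (min_le_of_right_le (by linarith))
      rw [h2]
      simp
  have h1 : ∫⁻ x, ENNReal.ofReal (truncLog (Real.log n) x ^ 2) ≤ ENNReal.ofReal 4 := by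
    rw [lintegral_fold _ (by fun_prop)]
    have hev : ∀ x, truncLog (Real.log n) (-x) = truncLog (Real.log n) x := fun x => by
      simp [truncLog]
    have h2 : ∫⁻ x in Ioi (0 : ℝ), ENNReal.ofReal (truncLog (Real.log n) x ^ 2) ≤
        ENNReal.ofReal 2 := by
      refine (setLIntegral_mono' measurableSet_Ioi hle).trans ?_
      refine (setLIntegral_le_lintegral _ _).trans ?_
      rw [lintegral_indicator measurableSet_Ioc, lintegral_log_sq_mul_pow]
      norm_num
    simp only [hev]
    rw [lintegral_add_left (by fun_prop), show (4 : ℝ) = 2 + 2 by norm_num,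
      ENNReal.ofReal_add zero_le_two zero_le_two]
    exact add_le_add h2 h2
  have e : ∀ᵐ x : ℝ, ENNReal.ofReal (moser n x ^ 2) =
      ENNReal.ofReal (1 / (Real.pi * Real.log n)) *
        ENNReal.ofReal (truncLog (Real.log n) x ^ 2) := by
    filter_upwards [moser_ae_eq hn] with x hx
    rw [hx, ← ENNReal.ofReal_mul (by positivity), mul_pow, div_pow,
      Real.sq_sqrt (by positivity), one_pow]
  rw [lintegral_congr_ae e, lintegral_const_mul' _ _ ENNReal.ofReal_ne_top]
  refine (mul_le_mul_right h1 _).trans_eq ?_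
  rw [← ENNReal.ofReal_mul (by positivity)]
  congr 1
  field_simp

lemma integrable_moser_sq {n : ℕ} (hn : 2 ≤ n) : Integrable (fun x => moser n x ^ 2) := by
  refine ⟨((measurable_moser n).pow_const 2).aestronglyMeasurable, ?_⟩
  rw [hasFiniteIntegral_iff_ofReal (ae_of_all _ fun x => sq_nonneg _)]
  exact (lintegral_moser_sq_le hn).trans_lt ENNReal.ofReal_lt_top

lemma integral_moser_sq_le {n : ℕ} (hn : 2 ≤ n) :
    ∫ x, moser n x ^ 2 ≤ 4 / (Real.pi * Real.log n) := by
  have hL : 0 ≤ Real.log n := Real.log_natCast_nonneg n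
  have hp := Real.pi_pos
  rw [integral_eq_lintegral_of_nonneg_ae (ae_of_all _ fun x => sq_nonneg _)
    ((measurable_moser n).pow_const 2).aestronglyMeasurable]
  exact ENNReal.toReal_le_of_le_ofReal (by positivity) (lintegral_moser_sq_le hn)

lemma integral_moser_sq_pos {n : ℕ} (hn : 2 ≤ n) : 0 < ∫ x, moser n x ^ 2 := by
  have hn1 : (1 : ℝ) < n := by exact_mod_cast hn
  have hL : 0 < Real.log n := Real.log_pos hn1
  have hp := Real.pi_pos
  have hn0 : (0 : ℝ) < 1 / n := by
    have : (0 : ℝ) < n := by linarith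
    positivity
  rw [integral_pos_iff_support_of_nonneg (fun x => sq_nonneg _) (integrable_moser_sq hn)]
  have hsub : Ioo (-(1 / n) : ℝ) (1 / n) ⊆ Function.support fun x => moser n x ^ 2 := by
    intro x hx
    have : 0 < moser n x := by
      rw [moser_eq_plateau (abs_lt.2 hx)]
      positivity
    exact (pow_pos this 2).ne'
  refine lt_of_lt_of_le ?_ (measure_mono hsub)
  rw [Real.volume_Ioo, ENNReal.ofReal_pos]
  linarith

lemma memHhalf_moser {n : ℕ} (hn : 2 ≤ n) : MemHhalf (moser n) :=
  ⟨(memLp_two_iff_integrable_sq (measurable_moser n).aestronglyMeasurable).2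
    (integrable_moser_sq hn), integrable_gagliardo_moser hn⟩

/-! ### The Riesz double integral of bounded functions supported in `[-1, 1]` -/

/-- The double integral `∫ (I_μ * h) k`. -/
def riesz2 (μ : ℝ) (h k : ℝ → ℝ) : ℝ := ∫ x, rieszConv μ h x * k x

/-- `h` is measurable, bounded by `B`, and vanishes outside `[-1, 1]`. -/
structure BddSupp (B : ℝ) (h : ℝ → ℝ) : Prop where
  meas : Measurable h
  bound : ∀ x, |h x| ≤ B
  supp : ∀ x, 1 < |x| → h x = 0

lemma BddSupp.nonneg {B : ℝ} {h : ℝ → ℝ} (hh : BddSupp B h) : 0 ≤ B :=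
  (abs_nonneg _).trans (hh.bound 0)

/-- The Riesz kernel cut off to `[-2, 2]`, the set of differences of points of `[-1, 1]`. -/
def cutKernel (μ : ℝ) : ℝ → ℝ := (Icc (-2 : ℝ) 2).indicator fun y => 1 / |y| ^ μ

lemma cutKernel_nonneg (μ y : ℝ) : 0 ≤ cutKernel μ y :=
  indicator_nonneg (fun y _ => by positivity) y

lemma integrable_cutKernel {μ : ℝ} (hμ : μ < 1) : Integrable (cutKernel μ) := by
  have h1 : IntervalIntegrable (fun y : ℝ => y ^ (-μ)) volume 0 2 :=
    intervalIntegral.intervalIntegrable_rpow' (by linarith)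
  have h2 : IntervalIntegrable (fun y : ℝ => 1 / |y| ^ μ) volume 0 2 := by
    refine h1.congr ?_
    intro y hy
    rw [uIoc_of_le zero_le_two] at hy
    simp only
    rw [abs_of_pos hy.1, Real.rpow_neg hy.1.le, one_div]
  have h3 : IntervalIntegrable (fun y : ℝ => 1 / |y| ^ μ) volume 0 (-2) := by
    have := h2.comp_sub_left 0
    simpa using this
  have h4 := h3.symm.trans h2
  rw [intervalIntegrable_iff_integrableOn_Icc_of_le (by norm_num)] at h4
  exact h4.integrable_indicator measurableSet_Icc

lemma norm_riesz_integrand_le {μ B : ℝ} {h : ℝ → ℝ} (hh : BddSupp B h) {x : ℝ} (hx : |x| ≤ 1)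
    (y : ℝ) : ‖1 / |x - y| ^ μ * h y‖ ≤ B * cutKernel μ (x - y) := by
  rcases lt_or_ge 1 |y| with hy | hy
  · rw [hh.supp y hy, mul_zero, norm_zero]
    exact mul_nonneg hh.nonneg (cutKernel_nonneg _ _)
  · have : x - y ∈ Icc (-2 : ℝ) 2 := by
      rw [abs_le] at hx hy
      constructor <;> linarith
    rw [cutKernel, indicator_of_mem this, norm_mul, mul_comm, Real.norm_eq_abs, Real.norm_eq_abs,
      abs_of_nonneg (show 0 ≤ 1 / |x - y| ^ μ by positivity)]
    gcongr
    exact hh.bound y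

lemma integrable_riesz_integrand {μ B : ℝ} (hμ : μ < 1) {h : ℝ → ℝ} (hh : BddSupp B h) {x : ℝ}
    (hx : |x| ≤ 1) : Integrable fun y => 1 / |x - y| ^ μ * h y := by
  have hm := hh.meas
  refine (((integrable_cutKernel hμ).comp_sub_left x).const_mul B).mono' ?_
    (ae_of_all _ (norm_riesz_integrand_le hh hx))
  exact Measurable.aestronglyMeasurable (by fun_prop)

lemma abs_rieszConv_le {μ B : ℝ} (hμ : μ < 1) {h : ℝ → ℝ} (hh : BddSupp B h) {x : ℝ}
    (hx : |x| ≤ 1) : |rieszConv μ h x| ≤ B * ∫ y, cutKernel μ y := by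
  have := norm_integral_le_of_norm_le (((integrable_cutKernel hμ).comp_sub_left x).const_mul B)
    (ae_of_all _ (norm_riesz_integrand_le (μ := μ) hh hx))
  rwa [integral_const_mul, integral_sub_left_eq_self (cutKernel μ) volume x] at this

lemma measurable_rieszConv (μ : ℝ) {h : ℝ → ℝ} (hm : Measurable h) :
    Measurable (rieszConv μ h) := by
  have : StronglyMeasurable (Function.uncurry fun x y : ℝ => 1 / |x - y| ^ μ * h y) :=
    Measurable.stronglyMeasurable (by fun_prop)
  exact this.integral_prod_right.measurable

lemma norm_rieszConv_mul_le {μ B B' : ℝ} (hμ : μ < 1) {h k : ℝ → ℝ} (hh : BddSupp B h)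
    (hk : BddSupp B' k) (x : ℝ) :
    ‖rieszConv μ h x * k x‖ ≤
      (Icc (-1 : ℝ) 1).indicator (fun _ => B * (∫ y, cutKernel μ y) * B') x := by
  rcases lt_or_ge 1 |x| with hx | hx
  · rw [hk.supp x hx, mul_zero, norm_zero]
    apply indicator_nonneg
    intro _ _
    have := integral_nonneg (μ := volume) (f := cutKernel μ) (cutKernel_nonneg μ)
    exact mul_nonneg (mul_nonneg hh.nonneg this) hk.nonneg
  · rw [indicator_of_mem (show x ∈ Icc (-1 : ℝ) 1 from abs_le.1 hx), norm_mul]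
    have h1 := abs_rieszConv_le hμ hh hx
    exact mul_le_mul h1 (hk.bound x) (norm_nonneg _) ((abs_nonneg _).trans h1)

lemma integrable_rieszConv_mul {μ B B' : ℝ} (hμ : μ < 1) {h k : ℝ → ℝ} (hh : BddSupp B h)
    (hk : BddSupp B' k) : Integrable fun x => rieszConv μ h x * k x := by
  refine Integrable.mono' (g := (Icc (-1 : ℝ) 1).indicator
    (fun _ => B * (∫ y, cutKernel μ y) * B')) ?_ ?_ (ae_of_all _ (norm_rieszConv_mul_le hμ hh hk))
  · exact (integrable_indicator_iff measurableSet_Icc).2 (integrableOn_const (by simp))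
  · exact ((measurable_rieszConv μ hh.meas).mul hk.meas).aestronglyMeasurable

lemma rieszConv_nonneg (μ : ℝ) {h : ℝ → ℝ} (h0 : ∀ x, 0 ≤ h x) (x : ℝ) : 0 ≤ rieszConv μ h x :=
  integral_nonneg fun y => mul_nonneg (by positivity) (h0 y)

lemma riesz2_nonneg (μ : ℝ) {h k : ℝ → ℝ} (h0 : ∀ x, 0 ≤ h x) (k0 : ∀ x, 0 ≤ k x) :
    0 ≤ riesz2 μ h k :=
  integral_nonneg fun x => mul_nonneg (rieszConv_nonneg μ h0 x) (k0 x)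

lemma riesz2_mono {μ B B' C C' : ℝ} (hμ : μ < 1) {h h' k k' : ℝ → ℝ} (hh : BddSupp B h)
    (hh' : BddSupp B' h') (hk : BddSupp C k) (hk' : BddSupp C' k') (k0 : ∀ x, 0 ≤ k x)
    (h0 : ∀ x, 0 ≤ h' x) (hle : ∀ x, h x ≤ h' x) (kle : ∀ x, k x ≤ k' x) :
    riesz2 μ h k ≤ riesz2 μ h' k' := by
  refine integral_mono (integrable_rieszConv_mul hμ hh hk) (integrable_rieszConv_mul hμ hh' hk') ?_
  intro x
  simp only
  rcases lt_or_ge 1 |x| with hx | hx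
  · rw [hk.supp x hx, hk'.supp x hx, mul_zero, mul_zero]
  · have : rieszConv μ h x ≤ rieszConv μ h' x :=
      integral_mono (integrable_riesz_integrand hμ hh hx) (integrable_riesz_integrand hμ hh' hx)
        fun y => mul_le_mul_of_nonneg_left (hle y) (by positivity)
    exact mul_le_mul this (kle x) (k0 x) (rieszConv_nonneg μ h0 x)

lemma riesz2_const_mul (μ c d : ℝ) (h k : ℝ → ℝ) :
    riesz2 μ (fun x => c * h x) (fun x => d * k x) = c * d * riesz2 μ h k := by
  have e : ∀ x, rieszConv μ (fun x => c * h x) x = c * rieszConv μ h x := by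
    intro x
    simp only [rieszConv]
    rw [← integral_const_mul]
    congr 1
    ext y
    ring
  simp only [riesz2, e]
  rw [← integral_const_mul]
  congr 1
  ext y
  ring

lemma rieszConv_comp_mul (μ : ℝ) (h : ℝ → ℝ) {s : ℝ} (hs : 0 < s) (x : ℝ) :
    rieszConv μ (fun y => h (s * y)) x = s ^ (μ - 1) * rieszConv μ h (s * x) := by
  have e : ∀ y, 1 / |x - y| ^ μ * h (s * y) =
      s ^ μ * (fun z => 1 / |s * x - z| ^ μ * h z) (s * y) := by
    intro y
    have hsμ : s ^ μ ≠ 0 := (Real.rpow_pos_of_pos hs μ).ne'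
    simp only
    rw [← mul_sub, abs_mul, abs_of_pos hs, Real.mul_rpow hs.le (abs_nonneg _)]
    field_simp
  simp only [rieszConv]
  simp_rw [e]
  rw [integral_const_mul, Measure.integral_comp_mul_left (fun z => 1 / |s * x - z| ^ μ * h z),
    abs_of_pos (inv_pos.2 hs), smul_eq_mul,
    ← mul_assoc, Real.rpow_sub_one hs.ne', div_eq_mul_inv]

lemma riesz2_comp_mul (μ : ℝ) (h k : ℝ → ℝ) {s : ℝ} (hs : 0 < s) :
    riesz2 μ (fun y => h (s * y)) (fun y => k (s * y)) = s ^ (μ - 2) * riesz2 μ h k := by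
  simp only [riesz2, rieszConv_comp_mul μ h hs, mul_assoc]
  rw [integral_const_mul, Measure.integral_comp_mul_left (fun x => rieszConv μ h x * k x),
    abs_of_pos (inv_pos.2 hs), smul_eq_mul, ← mul_assoc,
    show μ - 2 = μ - 1 - 1 by ring, Real.rpow_sub_one hs.ne' (μ - 1), div_eq_mul_inv]

lemma continuousOn_riesz2 {μ B C : ℝ} (hμ : μ < 1) {s : Set ℝ} {H K : ℝ → ℝ → ℝ}
    (hH : ∀ t ∈ s, BddSupp B (H t)) (hK : ∀ t ∈ s, BddSupp C (K t))
    (cH : ∀ x, ContinuousOn (fun t => H t x) s) (cK : ∀ x, ContinuousOn (fun t => K t x) s) :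
    ContinuousOn (fun t => riesz2 μ (H t) (K t)) s := by
  refine continuousOn_of_dominated (bound := (Icc (-1 : ℝ) 1).indicator
    (fun _ => B * (∫ y, cutKernel μ y) * C)) ?_ ?_ ?_ ?_
  · exact fun t ht => (integrable_rieszConv_mul hμ (hH t ht) (hK t ht)).1
  · exact fun t ht => ae_of_all _ (norm_rieszConv_mul_le hμ (hH t ht) (hK t ht))
  · exact (integrable_indicator_iff measurableSet_Icc).2 (integrableOn_const (by simp))
  · refine ae_of_all _ fun x => ?_
    rcases lt_or_ge 1 |x| with hx | hx
    · refine continuousOn_const (c := (0 : ℝ)) |>.congr fun t ht => ?_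
      simp only
      rw [(hK t ht).supp x hx, mul_zero]
    · refine ContinuousOn.mul ?_ (cK x)
      refine continuousOn_of_dominated (bound := fun y => B * cutKernel μ (x - y)) ?_ ?_ ?_ ?_
      · exact fun t ht => (integrable_riesz_integrand hμ (hH t ht) hx).1
      · exact fun t ht => ae_of_all _ (norm_riesz_integrand_le (hH t ht) hx)
      · exact ((integrable_cutKernel hμ).comp_sub_left x).const_mul B
      · exact ae_of_all _ fun y => continuousOn_const.mul (cH y)

lemma riesz2_ge {μ B C ε c d : ℝ} (hμ0 : 0 ≤ μ) (hμ : μ < 1) {h k : ℝ → ℝ} (hh : BddSupp B h)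
    (hk : BddSupp C k) (h0 : ∀ x, 0 ≤ h x) (k0 : ∀ x, 0 ≤ k x) (hε : 0 < ε) (hε1 : ε ≤ 1)
    (hc : 0 ≤ c) (hd : 0 ≤ d) (hch : ∀ x, |x| < ε → c ≤ h x) (hdk : ∀ x, |x| < ε → d ≤ k x) :
    c * d * (2 * ε) ^ (2 - μ) ≤ riesz2 μ h k := by
  have h2 : 0 < 2 * ε := by linarith
  have hvol : ∀ m : ℝ, ∫ x, (Ioo (-ε) ε).indicator (fun _ => m) x = 2 * ε * m := by
    intro m
    rw [integral_indicator measurableSet_Ioo, setIntegral_const, smul_eq_mul, Measure.real,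
      Real.volume_Ioo, ENNReal.toReal_ofReal (by linarith)]
    ring
  have hint : ∀ m : ℝ, Integrable ((Ioo (-ε) ε).indicator fun _ => m) := fun m =>
    (integrable_indicator_iff measurableSet_Ioo).2 (by simp)
  have hin : ∀ x, |x| < ε → 2 * ε * ((2 * ε) ^ (-μ) * c) ≤ rieszConv μ h x := by
    intro x hx
    rw [← hvol]
    refine integral_mono_ae (hint _) (integrable_riesz_integrand hμ hh (by linarith)) ?_
    -- at `y = x` the kernel takes the junk value `1 / 0 ^ μ = 0`
    have hne : ∀ᵐ y : ℝ, y ≠ x := by simp [ae_iff]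
    filter_upwards [hne] with y hy
    by_cases hyε : y ∈ Ioo (-ε) ε
    · rw [indicator_of_mem hyε, Real.rpow_neg h2.le, ← one_div]
      have hxy : 0 < |x - y| := abs_pos.2 (sub_ne_zero.2 hy.symm)
      have hle : |x - y| ≤ 2 * ε := by
        rw [abs_lt] at hx
        rw [abs_le]
        constructor <;> linarith [hyε.1, hyε.2]
      have := Real.rpow_pos_of_pos hxy μ
      gcongr
      exact hch y (abs_lt.2 hyε)
    · rw [indicator_of_notMem hyε]
      exact mul_nonneg (by positivity) (h0 y)
  have e : c * d * (2 * ε) ^ (2 - μ) = 2 * ε * (2 * ε * ((2 * ε) ^ (-μ) * c) * d) := by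
    rw [show 2 - μ = 1 + 1 + -μ by ring, Real.rpow_add h2, Real.rpow_add h2, Real.rpow_one]
    ring
  rw [e, ← hvol]
  refine integral_mono (hint _) (integrable_rieszConv_mul hμ hh hk) ?_
  intro x
  simp only
  by_cases hxε : x ∈ Ioo (-ε) ε
  · rw [indicator_of_mem hxε]
    have hx := abs_lt.2 hxε
    exact mul_le_mul (hin x hx) (hdk x hx) hd (rieszConv_nonneg μ h0 x)
  · rw [indicator_of_notMem hxε]
    exact mul_nonneg (rieszConv_nonneg μ h0 x) (k0 x)

/-! ### The nonlinearity along a ray -/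

/-- The growth conditions used on a nonlinearity `f` of one real variable, and on its companion
`g`: they hold for the restrictions of `F` and `F̃` to the ray through a point `(a, b)` with
`A = a² + b²`. -/
structure RayGrowth (μ A : ℝ) (f g : ℝ → ℝ) : Prop where
  cont : Continuous f
  cont' : Continuous g
  zero : f 0 = 0
  zero' : g 0 = 0
  pos : ∀ r, 0 < r → 0 < f r
  le : ∀ r, 0 ≤ r → f r ≤ g r
  scale : ∃ θ, 3 - μ < θ ∧ ∀ t r, 1 ≤ t → 0 ≤ r → t ^ θ * f r ≤ f (t * r)
  small : ∃ σ C η, 3 - μ < σ ∧ 0 ≤ C ∧ 0 < η ∧ ∀ r, 0 ≤ r → r < η → g r ≤ C * r ^ σ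
  large : ∃ c R, 0 < c ∧ 0 < R ∧
    ∀ r, R ≤ r → c * Real.exp (2 * Real.pi * A * r ^ 2) / r ^ 2 ≤ f r ^ 2

lemma radial_eq_fderiv (F : ℝ × ℝ → ℝ) (z : ℝ × ℝ) : radial F z = fderiv ℝ F z z := by
  have e : z = z.1 • ((1 : ℝ), (0 : ℝ)) + z.2 • ((0 : ℝ), (1 : ℝ)) := by
    ext <;> simp
  conv_rhs => rw [e]
  rw [map_add, map_smul, map_smul, radial, partial₁, partial₂, ← e, smul_eq_mul, smul_eq_mul]

lemma continuous_radial {F : ℝ × ℝ → ℝ} (hF : ContDiff ℝ 1 F) : Continuous (radial F) := by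
  have h : Continuous fun z => fderiv ℝ F z z :=
    (hF.continuous_fderiv one_ne_zero).clm_apply continuous_id
  exact h.congr fun z => (radial_eq_fderiv F z).symm

lemma lenSq_ray (a b r : ℝ) : lenSq (r * a, r * b) = (a ^ 2 + b ^ 2) * r ^ 2 := by
  simp only [lenSq]
  ring

lemma hasDerivAt_ray {F : ℝ × ℝ → ℝ} (hF : ContDiff ℝ 1 F) (a b r : ℝ) :
    HasDerivAt (fun r => F (r * a, r * b)) (fderiv ℝ F (r * a, r * b) (a, b)) r := by
  have h1 := (hF.differentiable one_ne_zero (r * a, r * b)).hasFDerivAt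
  have h2 : HasDerivAt (fun r : ℝ => (r * a, r * b)) (a, b) r := by
    simpa using (((hasDerivAt_id r).mul_const a).prodMk ((hasDerivAt_id r).mul_const b))
  exact h1.comp_hasDerivAt r h2

lemma mul_fderiv_ray (F : ℝ × ℝ → ℝ) (a b r : ℝ) :
    r * fderiv ℝ F (r * a, r * b) (a, b) = radial F (r * a, r * b) := by
  rw [radial_eq_fderiv, ← smul_eq_mul, ← map_smul]
  simp

lemma eq_zero_of_condAR {μ : ℝ} (hμ : μ < 1) {F : ℝ × ℝ → ℝ} (hF : ContDiff ℝ 1 F)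
    (h3 : CondAR μ F) : F 0 = 0 := by
  obtain ⟨θ, hθ, h⟩ := h3
  have hθ0 : 0 < θ := by linarith
  have hd : ∀ z, 0 ≤ θ * F z ∧ θ * F z ≤ radial F z := by
    have hcl : IsClosed {z | 0 ≤ θ * F z ∧ θ * F z ≤ radial F z} :=
      (isClosed_le continuous_const (continuous_const.mul hF.continuous)).inter
        (isClosed_le (continuous_const.mul hF.continuous) (continuous_radial hF))
    have hsub : ({0}ᶜ : Set (ℝ × ℝ)) ⊆ {z | 0 ≤ θ * F z ∧ θ * F z ≤ radial F z} :=
      fun z hz => ⟨(h z hz).1.le, (h z hz).2⟩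
    intro z
    exact closure_minimal hsub hcl ((dense_compl_singleton (0 : ℝ × ℝ)) z)
  have h0 := hd 0
  rw [radial_eq_fderiv, map_zero] at h0
  have : θ * F 0 = 0 := le_antisymm h0.2 h0.1
  exact (mul_eq_zero.1 this).resolve_left hθ0.ne'

lemma nonneg_of_condAR {μ : ℝ} (hμ : μ < 1) {F : ℝ × ℝ → ℝ} (hF : ContDiff ℝ 1 F)
    (h3 : CondAR μ F) (z : ℝ × ℝ) : 0 ≤ F z := by
  rcases eq_or_ne z 0 with rfl | hz
  · rw [eq_zero_of_condAR hμ hF h3]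
  · obtain ⟨θ, hθ, h⟩ := h3
    exact (pos_of_mul_pos_right (h z hz).1 (by linarith)).le

lemma le_Ftilde {μ : ℝ} (hμ : μ < 1) {F : ℝ × ℝ → ℝ} (hF : ContDiff ℝ 1 F)
    (h3 : CondAR μ F) (z : ℝ × ℝ) : F z ≤ Ftilde μ F z := by
  rcases eq_or_ne z 0 with rfl | hz
  · rw [Ftilde, eq_zero_of_condAR hμ hF h3, radial_eq_fderiv]
    simp
  · have h0 := nonneg_of_condAR hμ hF h3 z
    obtain ⟨θ, hθ, h⟩ := h3
    have := (h z hz).2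
    unfold Ftilde
    nlinarith

lemma ray_scale {F : ℝ × ℝ → ℝ} (hF : ContDiff ℝ 1 F) {θ : ℝ}
    (h : ∀ z : ℝ × ℝ, z ≠ 0 → θ * F z ≤ radial F z) (h0 : F 0 = 0) {a b : ℝ}
    (ha : 0 < a) {t r : ℝ} (ht : 1 ≤ t) (hr : 0 ≤ r) :
    t ^ θ * F (r * a, r * b) ≤ F (t * r * a, t * r * b) := by
  rcases hr.eq_or_lt with rfl | hr
  · have : F ((0 : ℝ), (0 : ℝ)) = 0 := h0
    simp [this]
  have hder : ∀ x : ℝ, 0 < x → HasDerivAt (fun x : ℝ => x ^ (-θ) * F (x * a, x * b))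
      (-θ * x ^ (-θ - 1) * F (x * a, x * b) +
        x ^ (-θ) * fderiv ℝ F (x * a, x * b) (a, b)) x := fun x hx =>
    (Real.hasDerivAt_rpow_const (Or.inl hx.ne')).mul (hasDerivAt_ray hF a b x)
  have hmono : MonotoneOn (fun x : ℝ => x ^ (-θ) * F (x * a, x * b)) (Ioi 0) := by
    refine monotoneOn_of_deriv_nonneg (convex_Ioi 0)
      (fun x hx => (hder x hx).continuousAt.continuousWithinAt)
      (fun x hx => ?_) (fun x hx => ?_)
    · rw [interior_Ioi] at hx
      exact (hder x hx).differentiableAt.differentiableWithinAt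
    · rw [interior_Ioi] at hx
      have hx : 0 < x := hx
      rw [(hder x hx).deriv]
      have hz : ((x * a, x * b) : ℝ × ℝ) ≠ 0 := by
        intro h'
        have := congrArg Prod.fst h'
        simp only [Prod.fst_zero] at this
        have : 0 < x * a := by positivity
        linarith
      have hle := h _ hz
      rw [← mul_fderiv_ray] at hle
      have e : x ^ (-θ) = x ^ (-θ - 1) * x := by
        rw [Real.rpow_sub_one hx.ne']
        field_simp
      rw [e]
      have hp := Real.rpow_pos_of_pos hx (-θ - 1)
      nlinarith
  have hm := hmono (show r ∈ Ioi (0 : ℝ) from hr) (show t * r ∈ Ioi (0 : ℝ) from by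
    have : 0 < t * r := by positivity
    exact this) (by nlinarith)
  simp only at hm
  rw [Real.mul_rpow (by linarith) hr.le, Real.rpow_neg hr.le, Real.rpow_neg (by linarith)] at hm
  have hrp := Real.rpow_pos_of_pos hr θ
  have htp := Real.rpow_pos_of_pos (show 0 < t by linarith) θ
  field_simp at hm
  rw [show t * r * a = r * a * t by ring, show t * r * b = r * b * t by ring, mul_comm]
  exact hm

lemma ray_small {μ a b : ℝ} (ha : 0 < a) (hb : 0 < b) {F : ℝ × ℝ → ℝ} (h1 : CondSmall μ F)
    (h0 : ∀ z, 0 ≤ F z) (hz : F 0 = 0) (hμ : μ < 1) :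
    ∃ σ C η, 3 - μ < σ ∧ 0 ≤ C ∧ 0 < η ∧
      ∀ r, 0 ≤ r → r < η → Ftilde μ F (r * a, r * b) ≤ C * r ^ σ := by
  obtain ⟨hF, κ, hκ, hp1, hp2⟩ := h1
  have hA : 0 < a ^ 2 + b ^ 2 := by positivity
  have htend : Tendsto (fun r : ℝ => (r * a, r * b)) (𝓝[>] 0) (𝓝[≠] (0 : ℝ × ℝ)) := by
    refine tendsto_nhdsWithin_iff.2 ⟨?_, ?_⟩
    · have : Continuous fun r : ℝ => (r * a, r * b) := by fun_prop
      have h := this.tendsto 0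
      simp only [zero_mul] at h
      exact h.mono_left nhdsWithin_le_nhds
    · filter_upwards [self_mem_nhdsWithin] with r hr h'
      have hr : 0 < r := hr
      have := congrArg Prod.fst h'
      simp only [Prod.fst_zero] at this
      have : 0 < r * a := by positivity
      linarith
  have he := ((hp1.comp htend).eventually (gt_mem_nhds one_pos)).and
    ((hp2.comp htend).eventually (gt_mem_nhds one_pos))
  obtain ⟨η, hη, hsub⟩ := mem_nhdsGT_iff_exists_Ioo_subset.1 he
  refine ⟨κ + 1, (a + b) * Real.sqrt (a ^ 2 + b ^ 2) ^ κ, η, by linarith, by positivity, hη, ?_⟩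
  intro r hr hrη
  rcases hr.eq_or_lt with rfl | hr
  · rw [Real.zero_rpow (by linarith), mul_zero, zero_mul, zero_mul]
    have e : ((0 : ℝ), (0 : ℝ)) = (0 : ℝ × ℝ) := rfl
    rw [e, Ftilde, radial_eq_fderiv, hz]
    simp
  · have hlen : len (r * a, r * b) = Real.sqrt (a ^ 2 + b ^ 2) * r := by
      rw [len, lenSq_ray, Real.sqrt_mul hA.le, Real.sqrt_sq hr.le]
    have hsp := Real.sqrt_pos.2 hA
    have hlp : 0 < len (r * a, r * b) ^ κ := by
      rw [hlen]
      positivity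
    have hh := hsub ⟨hr, hrη⟩
    simp only [mem_ofPred_eq, Function.comp] at hh
    rw [div_lt_one hlp, div_lt_one hlp] at hh
    have b1 := (le_abs_self _).trans hh.1.le
    have b2 := (le_abs_self _).trans hh.2.le
    calc Ftilde μ F (r * a, r * b) ≤ radial F (r * a, r * b) := by
          have := h0 (r * a, r * b)
          unfold Ftilde
          nlinarith
      _ ≤ r * a * len (r * a, r * b) ^ κ + r * b * len (r * a, r * b) ^ κ := by
          unfold radial
          simp only
          gcongr
      _ = _ := by
          rw [hlen, Real.mul_rpow hsp.le hr.le, Real.rpow_add_one hr.ne']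
          ring

/-- Integrating `d/dr F(r z)² = 2 F(r z) (r z · ∇F(r z)) / r ≥ β₀ e^{2π|r z|²} / r` turns the lower
bound on `F · (z · ∇F)` into a lower bound on `F²`, at the cost of a factor `1 / r²`. -/
lemma ray_large {a b : ℝ} (ha : 0 < a) (hb : 0 < b) {F : ℝ × ℝ → ℝ} (hF : ContDiff ℝ 1 F)
    (hpos : ∀ r, 0 < r → 0 < F (r * a, r * b)) (h7 : CondLower F) :
    ∃ c R, 0 < c ∧ 0 < R ∧ ∀ r, R ≤ r →
      c * Real.exp (2 * Real.pi * (a ^ 2 + b ^ 2) * r ^ 2) / r ^ 2 ≤ F (r * a, r * b) ^ 2 := by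
  obtain ⟨β, hβ, hlim⟩ := h7
  have hA : 0 < a ^ 2 + b ^ 2 := by positivity
  set A := a ^ 2 + b ^ 2 with hAdef
  have hpi := Real.pi_pos
  have hlt : ((β / 2 : ℝ) : EReal) < (β : EReal) := EReal.coe_lt_coe_iff.2 (by linarith)
  have hev := eventually_lt_of_lt_liminf (hlt.trans_le hlim)
  have htend : Tendsto (fun r : ℝ => (r * a, r * b)) atTop bothAtTop := by
    refine Tendsto.prodMk (tendsto_comap_iff.2 ?_) (tendsto_comap_iff.2 ?_)
    · exact tendsto_abs_atTop_atTop.comp (tendsto_id.atTop_mul_const ha)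
    · exact tendsto_abs_atTop_atTop.comp (tendsto_id.atTop_mul_const hb)
  obtain ⟨R, hRR⟩ := eventually_atTop.1 ((htend.eventually hev).and (eventually_gt_atTop 0))
  have hR0 := (hRR R le_rfl).2
  have hR := fun r hr => (hRR r hr).1
  have hfR := hpos R hR0
  set E : ℝ → ℝ := fun r => Real.exp (2 * Real.pi * A * r ^ 2) with hE
  have hEpos : ∀ r, 0 < E r := fun r => Real.exp_pos _
  -- the first bound makes `F² - c E / x²` nondecreasing, the second makes it nonnegative at `R`
  set c := min (β / (4 * Real.pi * A)) (F (R * a, R * b) ^ 2 * R ^ 2 / E R) with hc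
  have hc0 : 0 < c := by
    have := hEpos R
    exact lt_min (by positivity) (by positivity)
  refine ⟨c, R, hc0, hR0, fun r hr => ?_⟩
  have hlow : ∀ x, R ≤ x →
      β / 2 * E x ≤ F (x * a, x * b) * (x * fderiv ℝ F (x * a, x * b) (a, b)) := by
    intro x hx
    have h := EReal.coe_lt_coe_iff.1 (hR x hx)
    rw [lenSq_ray, ← hAdef, ← mul_fderiv_ray, ← mul_assoc (2 * Real.pi),
      lt_div_iff₀ (Real.exp_pos _)] at h
    exact h.le
  have hder : ∀ x : ℝ, 0 < x → HasDerivAt (fun x => F (x * a, x * b) ^ 2 - c * E x / x ^ 2)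
      (2 * F (x * a, x * b) * fderiv ℝ F (x * a, x * b) (a, b) -
        c * E x * (4 * Real.pi * A * x ^ 2 - 2) / x ^ 3) x := by
    intro x hx
    have d1 := (hasDerivAt_ray hF a b x).pow 2
    have d2 : HasDerivAt E (E x * (2 * Real.pi * A * (2 * x))) x := by
      have := ((hasDerivAt_pow 2 x).const_mul (2 * Real.pi * A)).exp
      simpa using this
    have d3 := (d2.const_mul c).div (hasDerivAt_pow 2 x) (by positivity)
    convert! d1.sub d3 using 1
    push_cast
    field_simp
    ring
  have hmono : MonotoneOn (fun x => F (x * a, x * b) ^ 2 - c * E x / x ^ 2) (Ici R) := by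
    refine monotoneOn_of_deriv_nonneg (convex_Ici R)
      (fun x hx => (hder x (hR0.trans_le hx)).continuousAt.continuousWithinAt)
      (fun x hx => ?_) (fun x hx => ?_)
    · rw [interior_Ici] at hx
      exact (hder x (hR0.trans hx)).differentiableAt.differentiableWithinAt
    · rw [interior_Ici] at hx
      have hxR : R < x := hx
      have hx0 : 0 < x := hR0.trans hxR
      rw [(hder x hx0).deriv, sub_nonneg, div_le_iff₀ (by positivity)]
      have hl := hlow x hxR.le
      have hcβ : c * (4 * Real.pi * A) ≤ β := by
        have := min_le_left (β / (4 * Real.pi * A)) (F (R * a, R * b) ^ 2 * R ^ 2 / E R)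
        rwa [← hc, le_div_iff₀ (by positivity)] at this
      calc c * E x * (4 * Real.pi * A * x ^ 2 - 2)
          ≤ c * E x * (4 * Real.pi * A * x ^ 2) := by
            have := (mul_pos hc0 (hEpos x)).le
            gcongr
            linarith
        _ = c * (4 * Real.pi * A) * (E x * x ^ 2) := by ring
        _ ≤ β * (E x * x ^ 2) := by
            have := (hEpos x).le
            gcongr
        _ = 2 * (β / 2 * E x) * x ^ 2 := by ring
        _ ≤ 2 * (F (x * a, x * b) * (x * fderiv ℝ F (x * a, x * b) (a, b))) * x ^ 2 := by gcongr
        _ = _ := by ring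
  have h0 : 0 ≤ F (R * a, R * b) ^ 2 - c * E R / R ^ 2 := by
    rw [sub_nonneg, div_le_iff₀ (by positivity), ← le_div_iff₀ (hEpos R)]
    exact min_le_right _ _
  have := hmono (mem_Ici.2 le_rfl) (mem_Ici.2 hr) hr
  simp only at this
  linarith

lemma rayGrowth_of_cond {μ a b : ℝ} (hμ : μ < 1) (ha : 0 < a) (hb : 0 < b) {F : ℝ × ℝ → ℝ}
    (h1 : CondSmall μ F) (h3 : CondAR μ F) (h7 : CondLower F) :
    RayGrowth μ (a ^ 2 + b ^ 2) (fun r => F (r * a, r * b))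
      (fun r => Ftilde μ F (r * a, r * b)) := by
  have hF := h1.1
  have h0 := eq_zero_of_condAR hμ hF h3
  have hnn := nonneg_of_condAR hμ hF h3
  have hFt : Continuous (Ftilde μ F) :=
    (continuous_radial hF).sub (continuous_const.mul hF.continuous)
  have hz : ((0 : ℝ), (0 : ℝ)) = (0 : ℝ × ℝ) := rfl
  have hpos : ∀ r, 0 < r → 0 < F (r * a, r * b) := by
    intro r hr
    obtain ⟨θ, hθ, h⟩ := h3
    refine pos_of_mul_pos_right (h _ ?_).1 (by linarith)
    intro h'
    have := congrArg Prod.fst h'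
    simp only [Prod.fst_zero] at this
    have : 0 < r * a := by positivity
    linarith
  refine ⟨hF.continuous.comp (by fun_prop), hFt.comp (by fun_prop), ?_, ?_, hpos,
    fun r _ => le_Ftilde hμ hF h3 _, ?_, ray_small ha hb h1 hnn h0 hμ, ray_large ha hb hF hpos h7⟩
  · simp [hz, h0]
  · simp [hz, h0, Ftilde, radial_eq_fderiv]
  · obtain ⟨θ, hθ, h⟩ := h3
    exact ⟨θ, hθ, fun t r ht hr => ray_scale hF (fun z hz => (h z hz).2) h0 ha ht hr⟩

/-! ### The fibre map in one variable -/

/-- A nonnegative function supported in `[-1, 1]` which attains its maximum `M > 0` on the interval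
`(-ε, ε)`. -/
structure Plateau (M ε : ℝ) (q : ℝ → ℝ) : Prop where
  meas : Measurable q
  nonneg : ∀ x, 0 ≤ q x
  le : ∀ x, q x ≤ M
  supp : ∀ x, 1 < |x| → q x = 0
  eq : ∀ x, |x| < ε → q x = M
  M_pos : 0 < M
  ε_pos : 0 < ε
  ε_le : ε ≤ 1

/-- `t² E / 2 - t^{2μ - 4} D(t) / 2`, where `D(t)` is the Riesz double integral of `f(t q)` with
itself; this is the value of `𝒥` along the fibre. -/
def fibreJ (μ E : ℝ) (f q : ℝ → ℝ) (t : ℝ) : ℝ :=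
  t ^ 2 * E / 2 - (t ^ 2) ^ (μ - 2) * riesz2 μ (fun x => f (t * q x)) (fun x => f (t * q x)) / 2

/-- The value of `P` along the fibre. -/
def fibreP (μ E : ℝ) (f g q : ℝ → ℝ) (t : ℝ) : ℝ :=
  t ^ 2 * E - (t ^ 2) ^ (μ - 2) * riesz2 μ (fun x => f (t * q x)) (fun x => g (t * q x))

lemma Plateau.exists_bddSupp {M ε : ℝ} {q : ℝ → ℝ} (hq : Plateau M ε q) {f : ℝ → ℝ}
    (hf : Continuous f) (hf0 : f 0 = 0) (T : ℝ) :
    ∃ B, ∀ t ∈ Icc 0 T, BddSupp B fun x => f (t * q x) := by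
  obtain ⟨B, hB⟩ := (isCompact_Icc (a := (0 : ℝ)) (b := T * M)).exists_bound_of_continuousOn
    hf.continuousOn
  refine ⟨B, fun t ht => ⟨hf.measurable.comp (hq.meas.const_mul t), fun x => ?_, fun x hx => ?_⟩⟩
  · refine hB _ ⟨mul_nonneg ht.1 (hq.nonneg x), ?_⟩
    exact mul_le_mul ht.2 (hq.le x) (hq.nonneg x) (ht.1.trans ht.2)
  · simp only [hq.supp x hx, mul_zero, hf0]

lemma BddSupp.const_mul {B : ℝ} {h : ℝ → ℝ} (hh : BddSupp B h) (c : ℝ) :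
    BddSupp (|c| * B) fun x => c * h x :=
  ⟨hh.meas.const_mul c, fun x => by
    rw [abs_mul]
    exact mul_le_mul_of_nonneg_left (hh.bound x) (abs_nonneg c), fun x hx => by
    rw [hh.supp x hx, mul_zero]⟩

lemma sq_rpow_sub_two (μ : ℝ) {t : ℝ} (ht : 0 ≤ t) : (t ^ 2) ^ (μ - 2) = t ^ (2 * (μ - 2)) := by
  rw [← Real.rpow_natCast t 2, ← Real.rpow_mul ht]
  norm_num

section

variable {μ A M ε E : ℝ} {f g q : ℝ → ℝ}

lemma RayGrowth.nonneg (hf : RayGrowth μ A f g) {r : ℝ} (hr : 0 ≤ r) : 0 ≤ f r := by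
  rcases hr.eq_or_lt with rfl | hr
  · rw [hf.zero]
  · exact (hf.pos r hr).le

lemma continuousOn_fibreJ (hμ : μ < 1) (hf : RayGrowth μ A f g) (hq : Plateau M ε q) {s T : ℝ}
    (hs : 0 < s) : ContinuousOn (fibreJ μ E f q) (Icc s T) := by
  obtain ⟨B, hB⟩ := hq.exists_bddSupp hf.cont hf.zero T
  have hB' : ∀ t ∈ Icc s T, BddSupp B fun x => f (t * q x) := fun t ht =>
    hB t ⟨hs.le.trans ht.1, ht.2⟩
  have hc : ∀ x, ContinuousOn (fun t => f (t * q x)) (Icc s T) := fun x =>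
    (hf.cont.comp (continuous_id.mul continuous_const)).continuousOn
  have h1 := continuousOn_riesz2 hμ hB' hB' hc hc
  have h2 : ContinuousOn (fun t : ℝ => (t ^ 2) ^ (μ - 2)) (Icc s T) := by
    refine ContinuousOn.rpow_const (by fun_prop) fun t ht => Or.inl ?_
    have : 0 < t := hs.trans_le ht.1
    positivity
  unfold fibreJ
  exact ContinuousOn.sub (by fun_prop) ((h2.mul h1).div_const 2)

lemma continuousOn_fibreP (hμ : μ < 1) (hf : RayGrowth μ A f g) (hq : Plateau M ε q) {s T : ℝ}
    (hs : 0 < s) : ContinuousOn (fibreP μ E f g q) (Icc s T) := by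
  obtain ⟨B, hB⟩ := hq.exists_bddSupp hf.cont hf.zero T
  obtain ⟨C, hC⟩ := hq.exists_bddSupp hf.cont' hf.zero' T
  have h1 := continuousOn_riesz2 hμ (s := Icc s T)
    (fun t ht => hB t ⟨hs.le.trans ht.1, ht.2⟩) (fun t ht => hC t ⟨hs.le.trans ht.1, ht.2⟩)
    (fun x => (hf.cont.comp (continuous_id.mul continuous_const)).continuousOn)
    (fun x => (hf.cont'.comp (continuous_id.mul continuous_const)).continuousOn)
  have h2 : ContinuousOn (fun t : ℝ => (t ^ 2) ^ (μ - 2)) (Icc s T) := by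
    refine ContinuousOn.rpow_const (by fun_prop) fun t ht => Or.inl ?_
    have : 0 < t := hs.trans_le ht.1
    positivity
  unfold fibreP
  exact ContinuousOn.sub (by fun_prop) (h2.mul h1)

lemma fibreJ_le (hf : RayGrowth μ A f g) (hq : Plateau M ε q) {t : ℝ} (ht : 0 ≤ t) :
    fibreJ μ E f q t ≤ t ^ 2 * E / 2 := by
  have h0 : ∀ x, 0 ≤ f (t * q x) := fun x => hf.nonneg (mul_nonneg ht (hq.nonneg x))
  have h1 := riesz2_nonneg μ h0 h0
  have : 0 ≤ (t ^ 2) ^ (μ - 2) * riesz2 μ (fun x => f (t * q x)) (fun x => f (t * q x)) / 2 := by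
    positivity
  unfold fibreJ
  linarith

lemma fibreP_le_two_mul_fibreJ (hμ : μ < 1) (hf : RayGrowth μ A f g) (hq : Plateau M ε q) {t : ℝ}
    (ht : 0 ≤ t) : fibreP μ E f g q t ≤ 2 * fibreJ μ E f q t := by
  have h0 : ∀ x, 0 ≤ t * q x := fun x => mul_nonneg ht (hq.nonneg x)
  obtain ⟨B, hB⟩ := hq.exists_bddSupp hf.cont hf.zero t
  obtain ⟨C, hC⟩ := hq.exists_bddSupp hf.cont' hf.zero' t
  have hB := hB t ⟨ht, le_rfl⟩
  have hC := hC t ⟨ht, le_rfl⟩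
  have h1 := riesz2_mono hμ hB hB hB hC (fun x => hf.nonneg (h0 x)) (fun x => hf.nonneg (h0 x))
    (fun x => le_rfl) (fun x => hf.le _ (h0 x))
  have h2 : 0 ≤ (t ^ 2) ^ (μ - 2) := by positivity
  unfold fibreP fibreJ
  nlinarith [mul_le_mul_of_nonneg_left h1 h2]

lemma fibreJ_nonpos_of_large (hμ0 : 0 < μ) (hμ : μ < 1) (hf : RayGrowth μ A f g)
    (hq : Plateau M ε q) : ∀ᶠ t in atTop, fibreJ μ E f q t ≤ 0 := by
  obtain ⟨θ, hθ, hsc⟩ := hf.scale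
  set D := riesz2 μ (fun x => f (q x)) (fun x => f (q x)) with hD
  have hbdd : ∀ t : ℝ, 0 ≤ t → ∃ B, BddSupp B fun x => f (t * q x) := fun t ht => by
    obtain ⟨B, hB⟩ := hq.exists_bddSupp hf.cont hf.zero t
    exact ⟨B, hB t ⟨ht, le_rfl⟩⟩
  obtain ⟨B₁, hB₁⟩ := hbdd 1 zero_le_one
  simp only [one_mul] at hB₁
  have hDpos : 0 < D := by
    have hfM := hf.pos M hq.M_pos
    have hn : ∀ x, 0 ≤ f (q x) := fun x => hf.nonneg (hq.nonneg x)
    have hp : ∀ x, |x| < ε → f M ≤ f (q x) := fun x hx => by rw [hq.eq x hx]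
    have h := riesz2_ge hμ0.le hμ hB₁ hB₁ hn hn hq.ε_pos hq.ε_le hfM.le hfM.le hp hp
    have hε := hq.ε_pos
    exact lt_of_lt_of_le (by positivity) h
  have hδ : 0 < 2 * θ + 2 * μ - 6 := by linarith
  filter_upwards [(tendsto_rpow_atTop hδ).eventually_ge_atTop (E / D), eventually_ge_atTop 1]
    with t ht ht1
  have ht0 : 0 < t := by linarith
  obtain ⟨B, hB⟩ := hbdd t ht0.le
  have hle : t ^ θ * t ^ θ * D ≤ riesz2 μ (fun x => f (t * q x)) (fun x => f (t * q x)) := by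
    rw [hD, ← riesz2_const_mul]
    have h0 : ∀ x, 0 ≤ f (t * q x) := fun x => hf.nonneg (mul_nonneg ht0.le (hq.nonneg x))
    have h0' : ∀ x, 0 ≤ t ^ θ * f (q x) := fun x =>
      mul_nonneg (by positivity) (hf.nonneg (hq.nonneg x))
    exact riesz2_mono hμ (hB₁.const_mul _) hB (hB₁.const_mul _) hB h0' h0
      (fun x => hsc t _ ht1 (hq.nonneg x)) (fun x => hsc t _ ht1 (hq.nonneg x))
  have hpow : (t ^ 2) ^ (μ - 2) * (t ^ θ * t ^ θ) = t ^ 2 * t ^ (2 * θ + 2 * μ - 6) := by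
    rw [sq_rpow_sub_two μ ht0.le, ← Real.rpow_add ht0, ← Real.rpow_add ht0, ← Real.rpow_natCast t 2,
      ← Real.rpow_add ht0]
    congr 1
    push_cast
    ring
  have h2 : t ^ 2 * E ≤
      (t ^ 2) ^ (μ - 2) * riesz2 μ (fun x => f (t * q x)) (fun x => f (t * q x)) := by
    rw [div_le_iff₀ hDpos] at ht
    calc t ^ 2 * E ≤ t ^ 2 * (t ^ (2 * θ + 2 * μ - 6) * D) := by gcongr
      _ = (t ^ 2) ^ (μ - 2) * (t ^ θ * t ^ θ * D) := by
        rw [← mul_assoc, ← hpow]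
        ring
      _ ≤ _ := by gcongr
  unfold fibreJ
  linarith

lemma fibreP_pos_of_small (hμ : μ < 1) (hf : RayGrowth μ A f g) (hq : Plateau M ε q)
    (hE : 0 < E) : ∀ᶠ t in 𝓝[>] 0, 0 < fibreP μ E f g q t := by
  obtain ⟨θ, hθ, hsc⟩ := hf.scale
  obtain ⟨σ, C, η, hσ, hC, hη, hsm⟩ := hf.small
  have hMpos := hq.M_pos
  set k : ℝ → ℝ := (Icc (-1 : ℝ) 1).indicator fun _ => C * M ^ σ with hk
  have hk0 : ∀ x, 0 ≤ k x := fun x => indicator_nonneg (fun _ _ => by positivity) x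
  have hkB : BddSupp (C * M ^ σ) k := by
    refine ⟨measurable_const.indicator measurableSet_Icc, fun x => ?_, fun x hx => ?_⟩
    · rw [abs_of_nonneg (hk0 x)]
      have : 0 ≤ C * M ^ σ := by positivity
      simp only [hk, indicator]
      split_ifs
      exacts [le_rfl, this]
    · rw [hk, indicator_of_notMem]
      exact fun h => absurd (abs_le.2 h) (not_le.2 hx)
  set D := riesz2 μ (fun x => f (q x)) k with hD
  have hbdd : ∀ (φ : ℝ → ℝ), Continuous φ → φ 0 = 0 → ∀ t : ℝ, 0 ≤ t →
      ∃ B, BddSupp B fun x => φ (t * q x) := fun φ hφ hφ0 t ht => by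
    obtain ⟨B, hB⟩ := hq.exists_bddSupp hφ hφ0 t
    exact ⟨B, hB t ⟨ht, le_rfl⟩⟩
  obtain ⟨B₁, hB₁⟩ := hbdd f hf.cont hf.zero 1 zero_le_one
  simp only [one_mul] at hB₁
  have hδ : 0 < θ + σ + 2 * μ - 6 := by linarith
  have htend : Tendsto (fun t : ℝ => t ^ (θ + σ + 2 * μ - 6) * D) (𝓝[>] 0) (𝓝 0) := by
    have hc : Continuous fun t : ℝ => t ^ (θ + σ + 2 * μ - 6) * D :=
      (Real.continuous_rpow_const hδ.le).mul continuous_const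
    have h := hc.tendsto 0
    rw [Real.zero_rpow hδ.ne', zero_mul] at h
    exact h.mono_left nhdsWithin_le_nhds
  have hηM : 0 < min 1 (η / M) := by positivity
  filter_upwards [htend.eventually (gt_mem_nhds hE), Ioo_mem_nhdsGT hηM] with t ht htI
  have ht0 : 0 < t := htI.1
  have ht1 : t ≤ 1 := htI.2.le.trans (min_le_left _ _)
  have htM : t * M < η := (lt_div_iff₀ hMpos).1 (htI.2.trans_le (min_le_right _ _))
  obtain ⟨B, hB⟩ := hbdd f hf.cont hf.zero t ht0.le
  obtain ⟨B', hB'⟩ := hbdd g hf.cont' hf.zero' t ht0.le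
  have h0 : ∀ x, 0 ≤ t * q x := fun x => mul_nonneg ht0.le (hq.nonneg x)
  have hfle : ∀ x, f (t * q x) ≤ t ^ θ * f (q x) := by
    intro x
    have h := hsc t⁻¹ (t * q x) ((one_le_inv₀ ht0).2 ht1) (h0 x)
    rw [inv_mul_cancel_left₀ ht0.ne', Real.inv_rpow ht0.le,
      inv_mul_le_iff₀ (Real.rpow_pos_of_pos ht0 θ)] at h
    exact h
  have hgle : ∀ x, g (t * q x) ≤ t ^ σ * k x := by
    intro x
    rcases lt_or_ge 1 |x| with hx | hx
    · rw [hkB.supp x hx, hq.supp x hx, mul_zero, hf.zero', mul_zero]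
    · have hqM : t * q x ≤ t * M := mul_le_mul_of_nonneg_left (hq.le x) ht0.le
      rw [hk, indicator_of_mem (show x ∈ Icc (-1 : ℝ) 1 from abs_le.1 hx)]
      calc g (t * q x) ≤ C * (t * q x) ^ σ := hsm _ (h0 x) (hqM.trans_lt htM)
        _ ≤ C * (t * M) ^ σ := by
          gcongr
          exact h0 x
          linarith
        _ = _ := by
          rw [Real.mul_rpow ht0.le hMpos.le]
          ring
  have hle : riesz2 μ (fun x => f (t * q x)) (fun x => g (t * q x)) ≤ t ^ θ * t ^ σ * D := by
    rw [hD, ← riesz2_const_mul]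
    exact riesz2_mono hμ hB (hB₁.const_mul _) hB' (hkB.const_mul _)
      (fun x => (hf.nonneg (h0 x)).trans (hf.le _ (h0 x)))
      (fun x => mul_nonneg (by positivity) (hf.nonneg (hq.nonneg x))) hfle hgle
  have hpow : (t ^ 2) ^ (μ - 2) * (t ^ θ * t ^ σ) = t ^ 2 * t ^ (θ + σ + 2 * μ - 6) := by
    rw [sq_rpow_sub_two μ ht0.le, ← Real.rpow_add ht0, ← Real.rpow_add ht0, ← Real.rpow_natCast t 2,
      ← Real.rpow_add ht0]
    congr 1
    push_cast
    ring
  have h2 : (t ^ 2) ^ (μ - 2) * riesz2 μ (fun x => f (t * q x)) (fun x => g (t * q x)) <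
      t ^ 2 * E := by
    calc _ ≤ (t ^ 2) ^ (μ - 2) * (t ^ θ * t ^ σ * D) := by gcongr
      _ = t ^ 2 * (t ^ (θ + σ + 2 * μ - 6) * D) := by
        rw [← mul_assoc, hpow]
        ring
      _ < t ^ 2 * E := by gcongr
  unfold fibreP
  linarith

/-- The fibre map is positive near `0` and nonpositive near infinity, which gives a maximum; so is
`fibreP`, being at most `2 * fibreJ`, which gives a zero. -/
lemma exists_isMaxOn_fibreJ_and_fibreP_eq_zero (hμ0 : 0 < μ) (hμ : μ < 1)
    (hf : RayGrowth μ A f g) (hq : Plateau M ε q) (hE : 0 < E) :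
    (∃ t, 0 < t ∧ IsMaxOn (fibreJ μ E f q) (Ici 0) t) ∧ ∃ s, 0 < s ∧ fibreP μ E f g q s = 0 := by
  obtain ⟨t₀, hP0, ht0⟩ := ((fibreP_pos_of_small hμ hf hq hE).and self_mem_nhdsWithin).exists
  have ht0 : 0 < t₀ := ht0
  have hJ0 : 0 < fibreJ μ E f q t₀ := by
    linarith [fibreP_le_two_mul_fibreJ (E := E) hμ hf hq ht0.le]
  obtain ⟨T₁, hT₁⟩ := eventually_atTop.1 (fibreJ_nonpos_of_large (E := E) hμ0 hμ hf hq)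
  set T := max T₁ t₀ with hT
  have hT0 : t₀ ≤ T := le_max_right _ _
  have hTJ : ∀ t, T ≤ t → fibreJ μ E f q t ≤ 0 := fun t ht => hT₁ t ((le_max_left _ _).trans ht)
  constructor
  · have htend : Tendsto (fun t : ℝ => t ^ 2 * E / 2) (𝓝[>] 0) (𝓝 0) := by
      have h : Continuous fun t : ℝ => t ^ 2 * E / 2 := by fun_prop
      have h := h.tendsto 0
      norm_num at h
      exact h.mono_left nhdsWithin_le_nhds
    obtain ⟨s, hs1, hs2⟩ :=
      ((htend.eventually (gt_mem_nhds hJ0)).and (Ioo_mem_nhdsGT ht0)).exists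
    obtain ⟨t, htI, htmax⟩ := (isCompact_Icc (a := s) (b := T)).exists_isMaxOn
      ⟨t₀, hs2.2.le, hT0⟩ (continuousOn_fibreJ (E := E) hμ hf hq hs2.1)
    refine ⟨t, hs2.1.trans_le htI.1, fun x hx => ?_⟩
    have hx : 0 ≤ x := hx
    have hmax0 : fibreJ μ E f q t₀ ≤ fibreJ μ E f q t := htmax ⟨hs2.2.le, hT0⟩
    rcases lt_or_ge x s with hxs | hxs
    · have : x ^ 2 * E / 2 ≤ s ^ 2 * E / 2 := by gcongr
      have := fibreJ_le (E := E) hf hq hx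
      simp only [mem_ofPred_eq]
      linarith
    · rcases le_or_gt x T with hxT | hxT
      · exact htmax ⟨hxs, hxT⟩
      · have := hTJ x hxT.le
        simp only [mem_ofPred_eq]
        linarith
  · have hPT : fibreP μ E f g q T ≤ 0 := by
      linarith [fibreP_le_two_mul_fibreJ (E := E) hμ hf hq (ht0.le.trans hT0), hTJ T le_rfl]
    obtain ⟨s, hs, hs0⟩ := intermediate_value_Icc' hT0
      (continuousOn_fibreP (E := E) hμ hf hq ht0) ⟨hPT, hP0.le⟩
    exact ⟨s, ht0.trans_le hs.1, hs0⟩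

/-- The upper estimate of the fibre map, with `L = log n` in mind. In terms of `S = t² A / δ` the
first part of the fibre map is at most `S / 2`, so that only `S ≥ (2 - μ) / 2` matters; there the
plateau alone contributes a second part of order
`L^{1 - μ} e^{2 y L} / S^{3 - μ}`, where `y = S - (2 - μ) / 2 ≥ 0`. -/
lemma fibreJ_lt {δ L c R : ℝ} (hμ0 : 0 < μ) (hμ : μ < 1)
    (hf : RayGrowth μ A f g) (hq : Plateau M (Real.exp (-L)) q) (hA : 0 < A) (hδ : 0 < δ)
    (hM : M ^ 2 = L / (Real.pi * δ)) (hEA : E ≤ A / δ) (hδL : δ ≤ 4 / (Real.pi * L))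
    (hL2 : 2 ≤ L) (hLR : 2 * Real.pi * A * R ^ 2 ≤ (2 - μ) * L) (hc : 0 < c)
    (hlarge : ∀ r, R ≤ r → c * Real.exp (2 * Real.pi * A * r ^ 2) / r ^ 2 ≤ f r ^ 2)
    (hLc : 1 ≤ (Real.pi * A / 4) ^ (2 - μ) * (c * (Real.pi * A)) / 2 * L ^ (1 - μ))
    {t : ℝ} (ht : 0 ≤ t) : fibreJ μ E f q t < (2 - μ) / 4 := by
  have hpi := Real.pi_pos
  have hL : 0 < L := by linarith
  set S := t ^ 2 * A / δ with hS
  have hES : t ^ 2 * E ≤ S := by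
    rw [hS, mul_div_assoc]
    gcongr
  rcases lt_or_ge S ((2 - μ) / 2) with hlt | hge
  · linarith [fibreJ_le (E := E) hf hq ht]
  have hSpos : 0 < S := by linarith
  have ht0 : 0 < t := by
    refine ht.lt_of_ne fun h => ?_
    rw [hS, ← h] at hSpos
    simp at hSpos
  set y := S - (2 - μ) / 2 with hy
  have hy0 : 0 ≤ y := by linarith
  have hr2 : (t * M) ^ 2 = S * L / (Real.pi * A) := by
    rw [mul_pow, hM, hS]
    field_simp
  have hRr : R ≤ t * M := by
    refine (le_abs_self R).trans (abs_le_of_sq_le_sq ?_ (mul_nonneg ht hq.M_pos.le))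
    rw [hr2, le_div_iff₀ (by positivity)]
    nlinarith
  have hfr : c * (Real.pi * A) * Real.exp (2 * S * L) / (S * L) ≤ f (t * M) ^ 2 := by
    refine le_trans (le_of_eq ?_) (hlarge _ hRr)
    rw [hr2]
    have : 2 * Real.pi * A * (S * L / (Real.pi * A)) = 2 * S * L := by field_simp
    rw [this]
    field_simp
  obtain ⟨B, hB⟩ := hq.exists_bddSupp hf.cont hf.zero t
  have hB := hB t ⟨ht, le_rfl⟩
  have h0 : ∀ x, 0 ≤ f (t * q x) := fun x => hf.nonneg (mul_nonneg ht (hq.nonneg x))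
  have hfM : 0 ≤ f (t * M) := hf.nonneg (mul_nonneg ht hq.M_pos.le)
  have hpl : ∀ x, |x| < Real.exp (-L) → f (t * M) ≤ f (t * q x) := fun x hx => by rw [hq.eq x hx]
  have hD := riesz2_ge hμ0.le hμ hB hB h0 h0 hq.ε_pos hq.ε_le hfM hfM hpl hpl
  have hD2 : c * (Real.pi * A) / (S * L) * Real.exp (2 * y * L) ≤
      riesz2 μ (fun x => f (t * q x)) (fun x => f (t * q x)) := by
    refine le_trans ?_ hD
    have e1 : Real.exp (-L) ^ (2 - μ) ≤ (2 * Real.exp (-L)) ^ (2 - μ) := by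
      have := Real.exp_pos (-L)
      apply Real.rpow_le_rpow this.le (by linarith) (by linarith)
    rw [← Real.exp_mul] at e1
    calc _ = c * (Real.pi * A) * Real.exp (2 * S * L) / (S * L) * Real.exp (-L * (2 - μ)) := by
          have : Real.exp (2 * y * L) = Real.exp (2 * S * L) * Real.exp (-L * (2 - μ)) := by
            rw [← Real.exp_add, hy]
            congr 1
            ring
          rw [this]
          ring
      _ ≤ f (t * M) ^ 2 * (2 * Real.exp (-L)) ^ (2 - μ) := by gcongr
      _ = _ := by ring
  have hW : (Real.pi * A / 4) ^ (2 - μ) * L ^ (2 - μ) / S ^ (2 - μ) ≤ (t ^ 2) ^ (μ - 2) := by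
    have e1 : (Real.pi * A / 4) ^ (2 - μ) * L ^ (2 - μ) / S ^ (2 - μ) =
        (Real.pi * A / 4 * L / S) ^ (2 - μ) := by
      rw [Real.div_rpow (by positivity) hSpos.le, Real.mul_rpow (by positivity) hL.le]
    have e2 : (t ^ 2) ^ (μ - 2) = ((t ^ 2)⁻¹) ^ (2 - μ) := by
      rw [Real.inv_rpow (by positivity), ← Real.rpow_neg (by positivity)]
      congr 1
      ring
    rw [e1, e2]
    apply Real.rpow_le_rpow (by positivity) _ (by linarith)
    rw [hS, le_inv_comm₀ (by positivity) (by positivity)]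
    rw [le_div_iff₀ (by positivity)] at hδL
    have : (Real.pi * A / 4 * L / (t ^ 2 * A / δ))⁻¹ = t ^ 2 * (4 / (Real.pi * L * δ)) := by
      field_simp
    rw [this]
    have h1 : 1 ≤ 4 / (Real.pi * L * δ) := by
      rw [le_div_iff₀ (by positivity)]
      linarith
    nlinarith [sq_nonneg t]
  have hSy : S ^ (2 - μ) * S ≤ (1 + y) ^ 3 := by
    have h1 : S ≤ 1 + y := by linarith
    rw [← Real.rpow_add_one hSpos.ne']
    calc S ^ (2 - μ + 1) ≤ (1 + y) ^ (2 - μ + 1) :=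
          Real.rpow_le_rpow hSpos.le h1 (by linarith)
      _ ≤ (1 + y) ^ (3 : ℝ) := Real.rpow_le_rpow_of_exponent_le (by linarith) (by linarith)
      _ = (1 + y) ^ 3 := by norm_cast
  have hexp : (1 + y) ^ 4 ≤ Real.exp (2 * y * L) := by
    have h1 : 1 + y ≤ Real.exp y := by linarith [Real.add_one_le_exp y]
    calc (1 + y) ^ 4 ≤ Real.exp y ^ 4 := by gcongr
      _ = Real.exp (4 * y) := by
        rw [← Real.exp_nat_mul]
        norm_num
      _ ≤ _ := Real.exp_le_exp.2 (by nlinarith)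
  have hmain : 1 + y ≤
      (t ^ 2) ^ (μ - 2) * riesz2 μ (fun x => f (t * q x)) (fun x => f (t * q x)) / 2 := by
    have hSp := Real.rpow_pos_of_pos hSpos (2 - μ)
    calc 1 + y = (1 + y) ^ 4 / (1 + y) ^ 3 := by
          have : 1 + y ≠ 0 := by positivity
          field_simp
      _ ≤ Real.exp (2 * y * L) / (S ^ (2 - μ) * S) := by gcongr
      _ ≤ (Real.pi * A / 4) ^ (2 - μ) * (c * (Real.pi * A)) / 2 * L ^ (1 - μ) *
            (Real.exp (2 * y * L) / (S ^ (2 - μ) * S)) :=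
          le_mul_of_one_le_left (by positivity) hLc
      _ = (Real.pi * A / 4) ^ (2 - μ) * L ^ (2 - μ) / S ^ (2 - μ) *
            (c * (Real.pi * A) / (S * L) * Real.exp (2 * y * L)) / 2 := by
          rw [show 2 - μ = 1 - μ + 1 by ring, Real.rpow_add_one hL.ne' (1 - μ)]
          field_simp
      _ ≤ _ := by gcongr
  unfold fibreJ
  linarith

end

/-! ### The Moser fibres and the Pohozaev manifold -/

/-- The Moser function normalised in `L²(ℝ)`. -/
def unitMoser (n : ℕ) (x : ℝ) : ℝ := moser n x / Real.sqrt (∫ y : ℝ, moser n y ^ 2)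

lemma normMoser_eq (n : ℕ) (c x : ℝ) : normMoser n c x = c * unitMoser n x := by
  rw [normMoser, unitMoser, mul_div_assoc]

lemma unitMoser_eq (n : ℕ) :
    unitMoser n = fun x => (Real.sqrt (∫ y : ℝ, moser n y ^ 2))⁻¹ * moser n (1 * x) := by
  ext x
  rw [unitMoser, one_mul, div_eq_inv_mul]

lemma integral_unitMoser_sq {n : ℕ} (hn : 2 ≤ n) : ∫ x, unitMoser n x ^ 2 = 1 := by
  have h := integral_moser_sq_pos hn
  simp only [unitMoser, div_pow, Real.sq_sqrt h.le]
  rw [integral_div, div_self h.ne']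

lemma memHhalf_unitMoser {n : ℕ} (hn : 2 ≤ n) : MemHhalf (unitMoser n) := by
  rw [unitMoser_eq]
  exact memHhalf_comp_mul (memHhalf_moser hn) _ one_ne_zero

lemma energy_unitMoser_le {n : ℕ} (hn : 2 ≤ n) :
    energy (unitMoser n) ≤ 1 / ∫ y : ℝ, moser n y ^ 2 := by
  have h := integral_moser_sq_pos hn
  rw [unitMoser_eq, energy_comp_mul _ _ one_ne_zero, inv_pow, Real.sq_sqrt h.le, one_div]
  exact mul_le_of_le_one_right (by positivity) (energy_moser_le hn)

lemma energy_unitMoser_pos {n : ℕ} (hn : 2 ≤ n) : 0 < energy (unitMoser n) :=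
  energy_pos (memHhalf_unitMoser hn) (by rw [integral_unitMoser_sq hn]; exact one_ne_zero)

lemma plateau_unitMoser {n : ℕ} (hn : 2 ≤ n) :
    Plateau (Real.sqrt (Real.log n / Real.pi) / Real.sqrt (∫ y : ℝ, moser n y ^ 2))
      (Real.exp (-Real.log n)) (unitMoser n) := by
  have h := Real.sqrt_pos.2 (integral_moser_sq_pos hn)
  have hn1 : (1 : ℝ) < n := by exact_mod_cast hn
  have hL : 0 < Real.log n := Real.log_pos hn1
  have hpi := Real.pi_pos
  refine ⟨(measurable_moser n).div_const _, fun x => div_nonneg (moser_nonneg n x) h.le,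
    fun x => div_le_div_of_nonneg_right (moser_le hn x) h.le, fun x hx => ?_, fun x hx => ?_,
    by positivity, Real.exp_pos _, Real.exp_le_one_iff.2 (by linarith)⟩
  · rw [unitMoser, moser_eq_zero (by lia) hx, zero_div]
  · rw [Real.exp_neg, Real.exp_log (by linarith), ← one_div] at hx
    rw [unitMoser, moser_eq_plateau hx]

variable {μ a b : ℝ} {F : ℝ × ℝ → ℝ}

lemma fibre_arg_eq (n : ℕ) (c t : ℝ) : (fun x => t * normMoser n c (t ^ 2 * x)) =
    fun x => (t * c) * unitMoser n (t ^ 2 * x) := by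
  ext x
  rw [normMoser_eq, mul_assoc]

lemma energy_fibre (n : ℕ) (c : ℝ) {t : ℝ} (ht : 0 < t) :
    energy (fun x => t * normMoser n c (t ^ 2 * x)) = t ^ 2 * (c ^ 2 * energy (unitMoser n)) := by
  rw [fibre_arg_eq, energy_comp_mul _ _ (by positivity)]
  ring

lemma riesz2_fibre (G : ℝ × ℝ → ℝ) (n : ℕ) {t : ℝ} (ht : 0 < t) :
    ∫ x, rieszConv μ (fun y => F (t * normMoser n a (t ^ 2 * y), t * normMoser n b (t ^ 2 * y))) x *
        G (t * normMoser n a (t ^ 2 * x), t * normMoser n b (t ^ 2 * x)) =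
      (t ^ 2) ^ (μ - 2) * riesz2 μ
        (fun x => (fun r => F (r * a, r * b)) (t * unitMoser n x))
        (fun x => (fun r => G (r * a, r * b)) (t * unitMoser n x)) := by
  rw [← riesz2_comp_mul μ _ _ (show 0 < t ^ 2 by positivity), riesz2]
  have e : ∀ c y, t * normMoser n c y = t * unitMoser n y * c := fun c y => by
    rw [normMoser_eq]
    ring
  simp only [e]

lemma fibre_eq_fibreJ (h0 : F 0 = 0) (hμ : μ < 1) (n : ℕ) {t : ℝ} (ht : 0 ≤ t) :
    fibre μ F a b n t = fibreJ μ ((a ^ 2 + b ^ 2) * energy (unitMoser n))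
      (fun r => F (r * a, r * b)) (unitMoser n) t := by
  rcases ht.eq_or_lt with rfl | ht
  -- at `t = 0` both sides vanish, the factor `(0 ^ 2) ^ (μ - 2)` being `0`
  · have hz : F ((0 : ℝ), (0 : ℝ)) = 0 := h0
    simp [fibre, J, energy, gagliardo, hz, fibreJ, Real.zero_rpow (show μ - 2 ≠ 0 by linarith)]
  · rw [fibre, J, energy_fibre n a ht, energy_fibre n b ht, riesz2_fibre F n ht, fibreJ]
    ring

lemma P_fibre_eq_fibreP (n : ℕ) {t : ℝ} (ht : 0 < t) :
    P μ F (fun x => t * normMoser n a (t ^ 2 * x)) (fun x => t * normMoser n b (t ^ 2 * x)) =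
      fibreP μ ((a ^ 2 + b ^ 2) * energy (unitMoser n)) (fun r => F (r * a, r * b))
        (fun r => Ftilde μ F (r * a, r * b)) (unitMoser n) t := by
  rw [P, energy_fibre n a ht, energy_fibre n b ht, riesz2_fibre (Ftilde μ F) n ht, fibreP]
  ring

lemma fibre_mem_sphere {n : ℕ} (hn : 2 ≤ n) (c : ℝ) {t : ℝ} (ht : 0 < t) :
    (fun x => t * normMoser n c (t ^ 2 * x)) ∈ sphere c := by
  rw [fibre_arg_eq]
  refine ⟨memHhalf_comp_mul (memHhalf_unitMoser hn) _ (by positivity), ?_⟩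
  simp only [mul_pow _ (unitMoser n _)]
  rw [integral_const_mul, Measure.integral_comp_mul_left (fun x => unitMoser n x ^ 2),
    integral_unitMoser_sq hn, abs_of_pos (by positivity), smul_eq_mul]
  field_simp

/-- On the Pohozaev manifold `2 𝒥 = ∫ (I_μ * F)(F̃ - F) ≥ 0`. The integral of `(I_μ * F) F̃` is
genuine there: it equals the energy, which is positive, while it would be `0` if the integrand were
not integrable. If `(I_μ * F) F` is not integrable, `J` reduces to the energy. -/
lemma J_nonneg_of_mem_pohozaev (hF0 : ∀ z, 0 ≤ F z) (hle : ∀ z, F z ≤ Ftilde μ F z) (ha : 0 < a)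
    {u v : ℝ → ℝ} (h : (u, v) ∈ pohozaev μ F a b) : 0 ≤ J μ F u v := by
  obtain ⟨hu, -, hP⟩ := h
  simp only at hu hP
  have hE : 0 < energy u := energy_pos hu.1 (by rw [hu.2]; positivity)
  have hE' := energy_nonneg v
  unfold P at hP
  have hint : Integrable fun x =>
      rieszConv μ (fun y => F (u y, v y)) x * Ftilde μ F (u x, v x) := by
    by_contra hni
    rw [integral_undef hni] at hP
    linarith
  have hI : ∫ x, rieszConv μ (fun y => F (u y, v y)) x * F (u x, v x) ≤
      energy u + energy v := by
    by_cases hi : Integrable fun x => rieszConv μ (fun y => F (u y, v y)) x * F (u x, v x)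
    · have := integral_mono hi hint fun x => mul_le_mul_of_nonneg_left (hle (u x, v x))
        (rieszConv_nonneg μ (fun y => hF0 (u y, v y)) x)
      linarith
    · rw [integral_undef hi]
      linarith
  unfold J
  linarith

lemma eventually_fibreJ_lt (hμ0 : 0 < μ) (hμ : μ < 1) {f g : ℝ → ℝ} {A : ℝ} (hA : 0 < A)
    (hf : RayGrowth μ A f g) : ∀ᶠ n : ℕ in atTop, ∀ t, 0 ≤ t →
      fibreJ μ (A * energy (unitMoser n)) f (unitMoser n) t < (2 - μ) / 4 := by
  obtain ⟨c, R, hc, hR, hlarge⟩ := hf.large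
  have hpi := Real.pi_pos
  set K := (Real.pi * A / 4) ^ (2 - μ) * (c * (Real.pi * A)) / 2 with hK
  have hK0 : 0 < K := by positivity
  have hlog : Tendsto (fun n : ℕ => Real.log n) atTop atTop :=
    Real.tendsto_log_atTop.comp tendsto_natCast_atTop_atTop
  have h2 := hlog.const_mul_atTop (show 0 < 2 - μ by linarith)
  have h3 := ((tendsto_rpow_atTop (show 0 < 1 - μ by linarith)).comp hlog).const_mul_atTop hK0
  filter_upwards [eventually_ge_atTop 2, hlog.eventually_ge_atTop 2,
    h2.eventually_ge_atTop (2 * Real.pi * A * R ^ 2), h3.eventually_ge_atTop 1] with n hn hL hLR hLc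
  intro t ht
  have hδ := integral_moser_sq_pos hn
  have hM : (Real.sqrt (Real.log n / Real.pi) / Real.sqrt (∫ y : ℝ, moser n y ^ 2)) ^ 2 =
      Real.log n / (Real.pi * ∫ y : ℝ, moser n y ^ 2) := by
    rw [div_pow, Real.sq_sqrt (by positivity), Real.sq_sqrt hδ.le, div_div]
  have hE : A * energy (unitMoser n) ≤ A / ∫ y : ℝ, moser n y ^ 2 := by
    rw [div_eq_mul_one_div]
    exact mul_le_mul_of_nonneg_left (energy_unitMoser_le hn) hA.le
  exact fibreJ_lt hμ0 hμ hf (plateau_unitMoser hn) hA hδ hM hE (integral_moser_sq_le hn) hL hLR hc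
    hlarge hLc ht

end Choquard

end

theorem lemma4p5 (μ a b : ℝ) (hμ₀ : 0 < μ) (hμ₁ : μ < 1) (ha : 0 < a) (hb : 0 < b)
    (F : ℝ × ℝ → ℝ) (hF₁ : Choquard.CondSmall μ F) (hF₂ : Choquard.CondCritical F)
    (hF₃ : Choquard.CondAR μ F) (hF₇ : Choquard.CondLower F) :
    (∃ N : ℕ, ∀ n : ℕ, N ≤ n →
      ∃ t : ℝ, 0 < t ∧ IsMaxOn (Choquard.fibre μ F a b n) (Set.Ici 0) t ∧
        Choquard.fibre μ F a b n t < (2 - μ) / 4) ∧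
    (Choquard.pohozaev μ F a b).Nonempty ∧
    BddBelow (Choquard.levels μ F a b) ∧
    Choquard.groundLevel μ F a b < (2 - μ) / 4 := by
  open Choquard in
  have hray := rayGrowth_of_cond hμ₁ ha hb hF₁ hF₃ hF₇
  have h0 := eq_zero_of_condAR hμ₁ hF₁.1 hF₃
  have hA : 0 < a ^ 2 + b ^ 2 := by positivity
  obtain ⟨N₀, hN₀⟩ := Filter.eventually_atTop.1 (eventually_fibreJ_lt hμ₀ hμ₁ hA hray)
  have hfib := fun n (hn : 2 ≤ n) => exists_isMaxOn_fibreJ_and_fibreP_eq_zero hμ₀ hμ₁ hray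
    (plateau_unitMoser hn) (mul_pos hA (energy_unitMoser_pos hn))
  have hbdd : BddBelow (levels μ F a b) := by
    refine ⟨0, ?_⟩
    rintro _ ⟨⟨u, v⟩, hw, rfl⟩
    exact J_nonneg_of_mem_pohozaev (nonneg_of_condAR hμ₁ hF₁.1 hF₃) (le_Ftilde hμ₁ hF₁.1 hF₃) ha hw
  set n := max N₀ 2 with hn
  have hn2 : 2 ≤ n := le_max_right _ _
  obtain ⟨s, hs, hPs⟩ := (hfib n hn2).2
  have hmem : ((fun x => s * normMoser n a (s ^ 2 * x)), (fun x => s * normMoser n b (s ^ 2 * x))) ∈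
      pohozaev μ F a b :=
    ⟨fibre_mem_sphere hn2 a hs, fibre_mem_sphere hn2 b hs, (P_fibre_eq_fibreP n hs).trans hPs⟩
  refine ⟨⟨n, fun m hm => ?_⟩, ⟨_, hmem⟩, hbdd, ?_⟩
  · obtain ⟨t, ht, hmax⟩ := (hfib m (hn2.trans hm)).1
    refine ⟨t, ht, fun x hx => ?_, ?_⟩
    · have hx : 0 ≤ x := hx
      simp only [Set.mem_ofPred_eq, fibre_eq_fibreJ h0 hμ₁ m hx, fibre_eq_fibreJ h0 hμ₁ m ht.le]
      exact hmax hx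
    · rw [fibre_eq_fibreJ h0 hμ₁ m ht.le]
      exact hN₀ m ((le_max_left _ _).trans hm) t ht.le
  · refine (csInf_le hbdd ⟨_, hmem, rfl⟩).trans_lt ?_
    have : fibre μ F a b n s < (2 - μ) / 4 := by
      rw [fibre_eq_fibreJ h0 hμ₁ n hs.le]
      exact hN₀ n (le_max_left _ _) s hs.le
    exact this
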